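/- **Setting.** Let $(\mathbb X,\mathcal X)$ be a measurable space, $\mu$ a complex measure on it, and $|\mu|$ its total variation. Let $u:\mathbb X\times\mathbb X\to\mathbb C\cup\{\infty\}$ be measurable and symmetric, where the value $\infty$ means $\operatorname{Re}u=+\infty$ and $e^{-\infty}=0$. Put $\zeta(x,y)=e^{-u(x,y)}-1$ (so $\zeta=-1$ where $u=\infty$), and let $\overline u(x,y)=u(x,y)$ where $u(x,y)\neq\infty$ and $\overline u(x,y)=1$ where $u(x,y)=\infty$. The partition function is $$Z=\sum_{n\ge0}\frac1{n!}\int d\mu(x_1)\cdots\int d\mu(x_n)\,\exp\Bigl\{-\sum_{1\le i<j\le n}u(x_i,x_j)\Bigr\},$$ the term $n=0$ being $1$. Let $\mathcal C_n$ be the set of connected (simple, unoriented) graphs on the vertex set $\{1,\dots,n\}$, and let $\varphi(x_1)=1$ and $$\varphi(x_1,\dots,x_n)=\frac1{n!}\sum_{G\in\mathcal C_n}\prod_{\{i,j\}\in G}\zeta(x_i,x_j)\qquad(n\ge2),$$ the product being over the edges of $G$. **Theorem (Cluster expansions).** Let $a,b:\mathbb X\to[0,\infty)$ be measurable functions such that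 1. (stability) for every $n$ and $|\mu|^{\otimes n}$-almost all $(x_1,\dots,x_n)$, $$\prod_{1\le i<j\le n}|1+\zeta(x_i,x_j)|\le\prod_{i=1}^n e^{b(x_i)};$$ and such that at least one of the following two conditions holds: 2. for $|\mu|$-almost all $x$, $\displaystyle\int d|\mu|(y)\,|\zeta(x,y)|\,e^{a(y)+2b(y)}\le a(x)$; 2′. for $|\mu|$-almost all $x$, $\displaystyle\int d|\mu|(y)\,|\overline u(x,y)|\,e^{a(y)+b(y)}\le a(x)$. Suppose also that $\int d|\mu|(y)\,e^{a(y)+2b(y)}<\infty$. Then the series defining $Z$ converges absolutely, and $$Z=\exp\Bigl\{\sum_{n\ge1}\int d\mu(x_1)\cdots d\mu(x_n)\,\varphi(x_1,\dots,x_n)\Bigr\},$$ where the series in the exponential converges absolutely, in the sense that $\sum_{n\ge1}\int d|\mu|(x_1)\cdots d|\mu|(x_n)\,|\varphi(x_1,\dots,x_n)|<\infty$. Furthermore, if condition 2 holds, then for $|\mu|$-almost all $x_1$, $$\sum_{n\ge2}n\int d|\mu|(x_2)\cdots\int d|\mu|(x_n)\,|\varphi(x_1,\dots,x_n)|\le(e^{a(x_1)}-1)\,e^{2b(x_1)};$$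 if condition 2′ holds, the same bound holds with $e^{b(x_1)}$ in place of $e^{2b(x_1)}$. -/

import Mathlib

open MeasureTheory
open scoped ENNReal Nat

noncomputable section

namespace ClusterExpansion

/-- The σ-algebra on `ℂ ∪ {⊤}`: a set is measurable iff its trace on `ℂ` is a Borel set.
The point `⊤` stands for a value whose real part is `+∞`. -/
instance extComplexMeasurableSpace : MeasurableSpace (WithTop ℂ) :=
  MeasurableSpace.map (fun w : ℂ => (w : WithTop ℂ)) inferInstance

/-- `w ↦ e^{-w}` on `ℂ ∪ {⊤}`, with `e^{-⊤} = 0`. -/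
def expNeg (w : WithTop ℂ) : ℂ := (w.map fun z : ℂ => Complex.exp (-z)).untopD 0

theorem expNeg_top : expNeg ⊤ = 0 := rfl

theorem expNeg_coe (z : ℂ) : expNeg (z : WithTop ℂ) = Complex.exp (-z) := rfl

section Model

variable {X : Type*}

/-- `ζ(x,y) = e^{-u(x,y)} - 1`. -/
def zeta (u : X → X → WithTop ℂ) (x y : X) : ℂ := expNeg (u x y) - 1

/-- `ū(x,y)`: equal to `u(x,y)` where this is finite and to `1` where `Re u(x,y) = ∞`. -/
def ubar (u : X → X → WithTop ℂ) (x y : X) : ℂ := (u x y).untopD 1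

/-- The pairs `(i,j)` with `i < j`. -/
def pairs (n : ℕ) : Finset (Fin n × Fin n) := Finset.univ.filter fun p => p.1 < p.2

/-- `exp(-∑_{i<j} u(x_i,x_j))`. -/
def boltzmann (u : X → X → WithTop ℂ) {n : ℕ} (x : Fin n → X) : ℂ :=
  expNeg (∑ p ∈ pairs n, u (x p.1) (x p.2))

open Classical in
/-- `φ(x_1,…,x_n) = (1/n!) ∑_G ∏_{{i,j} ∈ G} ζ(x_i,x_j)`, the sum being over the connected graphs
on `n` vertices. For `n = 1` this is `1`, see `phi_one`. -/
def phi (u : X → X → WithTop ℂ) {n : ℕ} (x : Fin n → X) : ℂ :=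
  ((n ! : ℕ) : ℂ)⁻¹ * ∑ G ∈ (Finset.univ : Finset (SimpleGraph (Fin n))).filter fun G => G.Connected,
    ∏ p ∈ (pairs n).filter fun p => G.Adj p.1 p.2, zeta u (x p.1) (x p.2)

open Classical in
theorem phi_one (u : X → X → WithTop ℂ) (x : Fin 1 → X) : phi u x = 1 := by
  have h : ((Finset.univ : Finset (SimpleGraph (Fin 1))).filter fun G => G.Connected)
      = Finset.univ :=
    Finset.filter_true_of_mem fun G _ => SimpleGraph.Connected.of_subsingleton
  have hp : pairs 1 = ∅ := by decide
  rw [phi, h]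
  simp [hp]

variable [MeasurableSpace X]

/-- The iterated integral `∫ dμ(x_1) ⋯ ∫ dμ(x_n) f(x_1,…,x_n)` against a complex measure. -/
def iterIntegral (μ : ComplexMeasure X) : (n : ℕ) → ((Fin n → X) → ℂ) → ℂ
  | 0, f => f Fin.elim0
  | n + 1, f =>
    ∫ᵛ x₁, iterIntegral μ n (fun y => f (Fin.cons x₁ y)) ∂[ContinuousLinearMap.mul ℝ ℂ; μ]

/-- The `n`-fold product `|μ| ⊗ ⋯ ⊗ |μ|` of the total variation of `μ`. -/
def absPi (μ : ComplexMeasure X) (n : ℕ) : Measure (Fin n → X) :=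
  Measure.pi fun _ => μ.variation

/-- The `n`-th term of the series defining the partition function. -/
def partitionTerm (μ : ComplexMeasure X) (u : X → X → WithTop ℂ) (n : ℕ) : ℂ :=
  ((n ! : ℕ) : ℂ)⁻¹ * iterIntegral μ n (boltzmann u)

/-- The partition function `Z`. -/
def partitionFunction (μ : ComplexMeasure X) (u : X → X → WithTop ℂ) : ℂ :=
  ∑' n : ℕ, partitionTerm μ u n

/-- The `n`-th cluster term `∫ dμ(x_1) ⋯ dμ(x_n) φ(x_1,…,x_n)`. -/
def clusterTerm (μ : ComplexMeasure X) (u : X → X → WithTop ℂ) (n : ℕ) : ℂ :=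
  iterIntegral μ n (phi u)

/-- Stability of the interaction, with stability function `b`. -/
def Stable (μ : ComplexMeasure X) (u : X → X → WithTop ℂ) (b : X → ℝ) : Prop :=
  ∀ n : ℕ, ∀ᵐ x ∂absPi μ n,
    ∏ p ∈ pairs n, ‖1 + zeta u (x p.1) (x p.2)‖ ≤ ∏ i, Real.exp (b (x i))

/-- The criterion of Kotecký–Preiss type, in terms of `|ζ|`. -/
def ZetaCriterion (μ : ComplexMeasure X) (u : X → X → WithTop ℂ) (a b : X → ℝ) : Prop :=
  ∀ᵐ x ∂μ.variation,
    ∫⁻ y, ENNReal.ofReal (‖zeta u x y‖ * Real.exp (a y + 2 * b y)) ∂μ.variation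
      ≤ ENNReal.ofReal (a x)

/-- The criterion in terms of `|ū|`. -/
def UbarCriterion (μ : ComplexMeasure X) (u : X → X → WithTop ℂ) (a b : X → ℝ) : Prop :=
  ∀ᵐ x ∂μ.variation,
    ∫⁻ y, ENNReal.ofReal (‖ubar u x y‖ * Real.exp (a y + b y)) ∂μ.variation
      ≤ ENNReal.ofReal (a x)

/-- `∑_{n ≥ 2} n ∫ d|μ|(x_2) ⋯ ∫ d|μ|(x_n) |φ(x_1,x_2,…,x_n)|` (with `n = m + 2`). -/
def rootedClusterSum (μ : ComplexMeasure X) (u : X → X → WithTop ℂ) (x₁ : X) : ℝ≥0∞ :=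
  ∑' m : ℕ, ((m + 2 : ℕ) : ℝ≥0∞) *
    ∫⁻ y : Fin (m + 1) → X, ENNReal.ofReal ‖phi u (Fin.cons x₁ y : Fin (m + 2) → X)‖ ∂absPi μ (m + 1)

end Model

end ClusterExpansion

end

noncomputable section

namespace ClusterExpansion

open Finset

section Combinatorics

theorem sum_le_sum_of_injOn {α β R : Type*} [DecidableEq β] [AddCommMonoid R] [PartialOrder R]
    [IsOrderedAddMonoid R] {s : Finset α} {t : Finset β} {f : α → R} {g : β → R} (i : α → β)
    (hi : ∀ x ∈ s, i x ∈ t) (hinj : Set.InjOn i s) (hfg : ∀ x ∈ s, f x ≤ g (i x))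
    (hg : ∀ y ∈ t, 0 ≤ g y) : ∑ x ∈ s, f x ≤ ∑ y ∈ t, g y := by
  calc ∑ x ∈ s, f x ≤ ∑ x ∈ s, g (i x) := sum_le_sum hfg
    _ = ∑ y ∈ s.image i, g y := (sum_image hinj).symm
    _ ≤ ∑ y ∈ t, g y := sum_le_sum_of_subset_of_nonneg
        (fun y hy => by obtain ⟨x, hx, rfl⟩ := mem_image.1 hy; exact hi x hx)
        fun y hy _ => hg y hy

theorem injective_mk_left {ι : Type*} (k : ι) : Function.Injective fun j => s(k, j) :=
  fun _ _ h => Sym2.congr_right.1 h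

/-- The edge set `E` has no edge joining `P` to its complement. -/
def NoCross {ι : Type*} (P : Set ι) (E : Finset (Sym2 ι)) : Prop :=
  ∀ i j, s(i, j) ∈ E → i ∈ P → j ∈ P

theorem NoCross.mono {ι : Type*} {P : Set ι} {E E' : Finset (Sym2 ι)} (h : NoCross P E') (hE : E ⊆ E') :
    NoCross P E := fun i j hij => h i j (hE hij)

theorem NoCross.compl {ι : Type*} {P : Set ι} {E : Finset (Sym2 ι)} (h : NoCross P E) : NoCross Pᶜ E :=
  fun i j hij hi hj => hi (h j i (by rwa [Sym2.eq_swap]) hj)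

variable {ι : Type*} [DecidableEq ι]

/-- The edges of the complete graph on `V`. -/
def edges (V : Finset ι) : Finset (Sym2 ι) := V.sym2.filter fun e => ¬ e.IsDiag

@[simp]
theorem mk_mem_edges {V : Finset ι} {i j : ι} :
    s(i, j) ∈ edges V ↔ i ∈ V ∧ j ∈ V ∧ i ≠ j := by
  simp [edges, and_assoc]

theorem edges_mono {V W : Finset ι} (h : V ⊆ W) : edges V ⊆ edges W :=
  filter_subset_filter _ (sym2_mono h)

theorem disjoint_edges {V W : Finset ι} (h : Disjoint V W) : Disjoint (edges V) (edges W) := by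
  rw [disjoint_left] at h ⊢
  intro e
  induction e with | _ i j
  simp only [mk_mem_edges]
  exact fun h1 h2 => h h1.1 h2.1

@[simp]
theorem edges_empty : edges (∅ : Finset ι) = ∅ := by simp [edges]

@[simp]
theorem edges_singleton (v : ι) : edges ({v} : Finset ι) = ∅ := by
  ext e
  induction e with | _ i j
  simp only [mk_mem_edges, mem_singleton, notMem_empty, iff_false]
  rintro ⟨rfl, rfl, h⟩
  exact h rfl

theorem edges_insert {k : ι} {W : Finset ι} (hk : k ∉ W) :
    edges (insert k W) = W.image (fun j => s(k, j)) ∪ edges W := by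
  ext e
  induction e with | _ i j
  simp only [mk_mem_edges, mem_insert, mem_union, mem_image, Sym2.eq_iff]
  constructor
  · rintro ⟨rfl | hi, rfl | hj, hij⟩
    · exact absurd rfl hij
    · exact Or.inl ⟨j, hj, Or.inl ⟨rfl, rfl⟩⟩
    · exact Or.inl ⟨i, hi, Or.inr ⟨rfl, rfl⟩⟩
    · exact Or.inr ⟨hi, hj, hij⟩
  · rintro (⟨a, ha, ⟨rfl, rfl⟩ | ⟨rfl, rfl⟩⟩ | ⟨hi, hj, hij⟩)
    · exact ⟨Or.inl rfl, Or.inr ha, fun h => hk (h ▸ ha)⟩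
    · exact ⟨Or.inr ha, Or.inl rfl, fun h => hk (h ▸ ha)⟩
    · exact ⟨Or.inr hi, Or.inr hj, hij⟩

@[to_additive]
theorem prod_edges_insert {R : Type*} [CommMonoid R] {k : ι} {W : Finset ι} (hk : k ∉ W)
    (f : Sym2 ι → R) :
    ∏ e ∈ edges (insert k W), f e = (∏ j ∈ W, f s(k, j)) * ∏ e ∈ edges W, f e := by
  rw [edges_insert hk, prod_union, prod_image (injective_mk_left k).injOn]
  rw [disjoint_left]
  intro e he
  obtain ⟨j, -, rfl⟩ := mem_image.1 he
  exact fun h => hk (mk_mem_edges.1 h).1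

@[to_additive]
theorem prod_edges_union {R : Type*} [CommMonoid R] {V W : Finset ι} (h : Disjoint V W)
    (f : Sym2 ι → R) : ∏ e ∈ edges (V ∪ W), f e =
      (∏ e ∈ edges V, f e) * (∏ e ∈ edges W, f e) * ∏ i ∈ V, ∏ j ∈ W, f s(i, j) := by
  induction V using Finset.induction_on with
  | empty => simp
  | insert k V hk ih =>
    have hd := disjoint_insert_left.1 h
    rw [insert_union, prod_edges_insert (by simp [hk, hd.1]), ih hd.2, prod_edges_insert hk,
      prod_union hd.2, prod_insert hk]
    simp only [mul_assoc, mul_left_comm, mul_comm]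

theorem noCross_union {A B : Finset ι} {E₁ E₂ : Finset (Sym2 ι)} (h : Disjoint A B)
    (h₁ : E₁ ⊆ edges A) (h₂ : E₂ ⊆ edges B) : NoCross (A : Set ι) (E₁ ∪ E₂) := by
  intro i j hij hi
  rcases mem_union.1 hij with hij | hij
  · exact (mk_mem_edges.1 (h₁ hij)).2.1
  · exact absurd (mk_mem_edges.1 (h₂ hij)).1 (disjoint_left.1 h hi)

/-- The graph with vertex set `V` and edge set `E` is connected. -/
def ConnOn (V : Finset ι) (E : Finset (Sym2 ι)) : Prop :=
  ∀ P : Set ι, NoCross P E → ∀ i ∈ V, ∀ j ∈ V, i ∈ P → j ∈ P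

theorem ConnOn.subset_of_union {A A' B' : Finset ι} {E₁ E₂ E₁' E₂' : Finset (Sym2 ι)} {v : ι}
    (hd' : Disjoint A' B') (h₁' : E₁' ⊆ edges A') (h₂' : E₂' ⊆ edges B')
    (hv : v ∈ A) (hv' : v ∈ A') (hc : ConnOn A E₁) (h : E₁ ∪ E₂ = E₁' ∪ E₂') : A ⊆ A' :=
  fun j hj => hc A' ((h ▸ noCross_union hd' h₁' h₂').mono subset_union_left) v hv j hj hv'

theorem left_eq_inter_edges {A B : Finset ι} {E₁ E₂ : Finset (Sym2 ι)} (hd : Disjoint A B)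
    (h₁ : E₁ ⊆ edges A) (h₂ : E₂ ⊆ edges B) : E₁ = (E₁ ∪ E₂) ∩ edges A := by
  rw [union_inter_distrib_right, inter_eq_left.2 h₁,
    disjoint_iff_inter_eq_empty.1 ((disjoint_edges hd).symm.mono_left h₂), union_empty]

theorem right_eq_inter_edges {A B : Finset ι} {E₁ E₂ : Finset (Sym2 ι)} (hd : Disjoint A B)
    (h₁ : E₁ ⊆ edges A) (h₂ : E₂ ⊆ edges B) : E₂ = (E₁ ∪ E₂) ∩ edges B := by
  rw [union_comm]
  exact left_eq_inter_edges hd.symm h₂ h₁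

/-- `∏ (1 + ζ)` over all the pairs of elements of `V`. -/
def fullProd {R : Type*} [CommRing R] (ζ : Sym2 ι → R) (V : Finset ι) : R :=
  ∏ e ∈ edges V, (1 + ζ e)

open Classical in
/-- The sum over the connected graphs on `V` of the product of `ζ` over the edges. -/
def connSum {R : Type*} [CommRing R] (ζ : Sym2 ι → R) (V : Finset ι) : R :=
  ∑ E ∈ (edges V).powerset.filter (ConnOn V), ∏ e ∈ E, ζ e

theorem connSum_singleton {R : Type*} [CommRing R] (ζ : Sym2 ι → R) (v : ι) :
    connSum ζ {v} = 1 := by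
  have : ConnOn {v} ∅ := by
    intro P _ i hi j hj
    simp_all
  simp [connSum, filter_singleton, this]

@[simp]
theorem fullProd_empty {R : Type*} [CommRing R] (ζ : Sym2 ι → R) : fullProd ζ ∅ = 1 := by
  simp [fullProd]

/-- A graph on `insert v V` is the union of the connected component of `v` and of a graph on the
remaining vertices. -/
theorem exists_component {v : ι} {V : Finset ι} {E : Finset (Sym2 ι)}
    (hE : E ⊆ edges (insert v V)) : ∃ S ⊆ V, ConnOn (insert v S) (E ∩ edges (insert v S)) ∧
      E ∩ edges (insert v S) ∪ E ∩ edges (V \ S) = E := by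
  classical
  set T := (insert v V).filter fun i => ∀ P : Set ι, NoCross P E → v ∈ P → i ∈ P with hT
  have hvT : v ∈ T := mem_filter.2 ⟨mem_insert_self _ _, fun _ _ h => h⟩
  have hTn : NoCross (T : Set ι) E := by
    intro i j hij hi
    exact mem_filter.2 ⟨(mk_mem_edges.1 (hE hij)).2.1,
      fun P hP hvP => hP i j hij ((mem_filter.1 hi).2 P hP hvP)⟩
  have hTV : T ⊆ insert v V := filter_subset _ _
  have key : ∀ P : Set ι, NoCross P (E ∩ edges T) → v ∈ P → ∀ j ∈ T, j ∈ P := by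
    intro P hP hvP j hj
    refine ((mem_filter.1 hj).2 (P ∩ T) ?_ ⟨hvP, hvT⟩).1
    intro i k hik hi
    have hk : k ∈ T := hTn i k hik hi.2
    exact ⟨hP i k (mem_inter.2 ⟨hik, mk_mem_edges.2
      ⟨hi.2, hk, (mk_mem_edges.1 (hE hik)).2.2⟩⟩) hi.1, hk⟩
  refine ⟨T.erase v, ?_, ?_, ?_⟩
  · intro i hi
    obtain ⟨h1, h2⟩ := mem_erase.1 hi
    exact (mem_insert.1 (hTV h2)).resolve_left h1
  · rw [insert_erase hvT]
    intro P hP i hi j hj hiP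
    by_cases hvP : v ∈ P
    · exact key P hP hvP j hj
    · exact absurd hiP (key _ hP.compl hvP i hi)
  · rw [insert_erase hvT, ← inter_union_distrib_left, inter_eq_left]
    intro e he
    induction e with | _ i j
    have h1 := mk_mem_edges.1 (hE he)
    by_cases hi : i ∈ T
    · exact mem_union_left _ (mk_mem_edges.2 ⟨hi, hTn i j he hi, h1.2.2⟩)
    · have hj : j ∉ T := fun hj => hi (hTn j i (by rwa [Sym2.eq_swap]) hj)
      have aux : ∀ k ∈ insert v V, k ∉ T → k ∈ V \ T.erase v := by
        intro k hk hkT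
        have : k ≠ v := fun h => hkT (h ▸ hvT)
        exact mem_sdiff.2 ⟨(mem_insert.1 hk).resolve_left this,
          fun h => hkT (mem_of_mem_erase h)⟩
      exact mem_union_right _ (mk_mem_edges.2 ⟨aux i h1.1 hi, aux j h1.2.1 hj, h1.2.2⟩)

theorem disjoint_insert_sdiff {v : ι} {V S : Finset ι} (hv : v ∉ V) :
    Disjoint (insert v S) (V \ S) := by
  rw [disjoint_insert_left]
  exact ⟨fun h => hv (mem_sdiff.1 h).1, disjoint_sdiff⟩

theorem fullProd_insert {R : Type*} [CommRing R] (ζ : Sym2 ι → R) {v : ι} {V : Finset ι}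
    (hv : v ∉ V) : fullProd ζ (insert v V) =
      ∑ S ∈ V.powerset, connSum ζ (insert v S) * fullProd ζ (V \ S) := by
  classical
  simp only [fullProd, connSum, prod_one_add, sum_mul_sum, sum_sigma']
  symm
  refine sum_bij (fun p _ => p.2.1 ∪ p.2.2) ?_ ?_ ?_ ?_
  · rintro ⟨S, E₁, E₂⟩ h
    simp only [mem_sigma, mem_powerset, mem_filter] at h ⊢
    exact union_subset (h.2.1.1.trans (edges_mono (insert_subset_insert _ h.1)))
      (h.2.2.trans (edges_mono (sdiff_subset.trans (subset_insert _ _))))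
  · rintro ⟨S, E₁, E₂⟩ h ⟨S', E₁', E₂'⟩ h' heq
    simp only [mem_sigma, mem_powerset, mem_filter] at h h' heq
    have hd := disjoint_insert_sdiff (S := S) hv
    have hd' := disjoint_insert_sdiff (S := S') hv
    have h1 := ConnOn.subset_of_union hd' h'.2.1.1 h'.2.2 (mem_insert_self v S)
      (mem_insert_self v S') h.2.1.2 heq
    have h2 := ConnOn.subset_of_union hd h.2.1.1 h.2.2 (mem_insert_self v S')
      (mem_insert_self v S) h'.2.1.2 heq.symm
    have hS : S = S' := by
      have := congrArg (fun T => T.erase v) (h1.antisymm h2)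
      simpa [erase_insert (fun h0 => hv (h.1 h0)), erase_insert (fun h0 => hv (h'.1 h0))] using this
    subst hS
    have e1 : E₁ = E₁' := by
      rw [left_eq_inter_edges hd h.2.1.1 h.2.2, heq, ← left_eq_inter_edges hd h'.2.1.1 h'.2.2]
    have e2 : E₂ = E₂' := by
      rw [right_eq_inter_edges hd h.2.1.1 h.2.2, heq, ← right_eq_inter_edges hd h'.2.1.1 h'.2.2]
    rw [e1, e2]
  · intro E hE
    obtain ⟨S, hS, hc, hu⟩ := exists_component (mem_powerset.1 hE)
    exact ⟨⟨S, E ∩ edges (insert v S), E ∩ edges (V \ S)⟩, by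
      simp [hS, hc, inter_subset_right], hu⟩
  · rintro ⟨S, E₁, E₂⟩ h
    simp only [mem_sigma, mem_powerset, mem_filter] at h
    exact (prod_union ((disjoint_edges (disjoint_insert_sdiff hv)).mono h.2.1.1 h.2.2)).symm

/-- Trees, given by their vertex set and their edge set. -/
inductive TreeOn : Finset ι → Finset (Sym2 ι) → Prop
  | single (v : ι) : TreeOn {v} ∅
  | join {V₁ V₂ : Finset ι} {E₁ E₂ : Finset (Sym2 ι)} {i j : ι} (hd : Disjoint V₁ V₂)
      (h₁ : TreeOn V₁ E₁) (h₂ : TreeOn V₂ E₂) (hi : i ∈ V₁) (hj : j ∈ V₂) :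
      TreeOn (V₁ ∪ V₂) (insert s(i, j) (E₁ ∪ E₂))

theorem TreeOn.subset_edges {V : Finset ι} {E : Finset (Sym2 ι)} (h : TreeOn V E) :
    E ⊆ edges V := by
  induction h with
  | single v => simp
  | @join V₁ V₂ E₁ E₂ i j hd _ _ hi hj ih₁ ih₂ =>
    refine insert_subset (mk_mem_edges.2 ⟨mem_union_left _ hi, mem_union_right _ hj, ?_⟩)
      (union_subset (ih₁.trans (edges_mono subset_union_left))
        (ih₂.trans (edges_mono subset_union_right)))
    rintro rfl
    exact disjoint_left.1 hd hi hj

theorem TreeOn.connOn {V : Finset ι} {E : Finset (Sym2 ι)} (h : TreeOn V E) : ConnOn V E := by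
  induction h with
  | single v =>
    intro P _ i hi j hj
    simp_all
  | @join V₁ V₂ E₁ E₂ i j hd _ _ hi hj ih₁ ih₂ =>
    intro P hP
    have c₁ := ih₁ P (hP.mono (subset_union_left.trans (subset_insert _ _)))
    have c₂ := ih₂ P (hP.mono (subset_union_right.trans (subset_insert _ _)))
    have hij : i ∈ P → j ∈ P := hP i j (mem_insert_self _ _)
    have hji : j ∈ P → i ∈ P := hP j i (by rw [Sym2.eq_swap]; exact mem_insert_self _ _)
    intro a ha b hb haP
    rcases mem_union.1 ha with ha | ha <;> rcases mem_union.1 hb with hb | hb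
    · exact c₁ a ha b hb haP
    · exact c₂ j hj b hb (hij (c₁ a ha i hi haP))
    · exact c₁ i hi b hb (hji (c₂ a ha j hj haP))
    · exact c₂ a ha b hb haP

theorem mk_notMem_union {A B : Finset ι} {E₁ E₂ : Finset (Sym2 ι)} {i j : ι} (hd : Disjoint A B)
    (h₁ : E₁ ⊆ edges A) (h₂ : E₂ ⊆ edges B) (hi : i ∈ A) (hj : j ∈ B) : s(i, j) ∉ E₁ ∪ E₂ :=
  fun h => disjoint_left.1 hd (noCross_union hd h₁ h₂ i j h hi) hj

/-- Removing the first edge of the path from `r` to `v` splits a tree in two. -/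
theorem TreeOn.exists_split {V : Finset ι} {E : Finset (Sym2 ι)} (h : TreeOn V E) {r v : ι}
    (hr : r ∈ V) (hv : v ∈ V) (hrv : r ≠ v) :
    ∃ A B E₁ E₂ j, Disjoint A B ∧ TreeOn A E₁ ∧ TreeOn B E₂ ∧ r ∈ A ∧ v ∈ B ∧ j ∈ B ∧
      A ∪ B = V ∧ E = insert s(r, j) (E₁ ∪ E₂) := by
  induction h generalizing v with
  | single w => simp_all
  | @join V₁ V₂ F₁ F₂ i j hd t₁ t₂ hi hj ih₁ ih₂ =>
    -- the root lies in the first part, the vertex `v` being replaced by the attaching vertex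
    have main : ∀ {V₁ V₂ : Finset ι} {F₁ F₂ : Finset (Sym2 ι)} {i j v : ι}, Disjoint V₁ V₂ →
        TreeOn V₁ F₁ → TreeOn V₂ F₂ → i ∈ V₁ → j ∈ V₂ → r ∈ V₁ → v ∈ V₁ ∪ V₂ → r ≠ v →
        (∀ {v}, r ∈ V₁ → v ∈ V₁ → r ≠ v →
          ∃ A B E₁ E₂ j, Disjoint A B ∧ TreeOn A E₁ ∧ TreeOn B E₂ ∧ r ∈ A ∧ v ∈ B ∧ j ∈ B ∧
            A ∪ B = V₁ ∧ F₁ = insert s(r, j) (E₁ ∪ E₂)) →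
        ∃ A B E₁ E₂ k, Disjoint A B ∧ TreeOn A E₁ ∧ TreeOn B E₂ ∧ r ∈ A ∧ v ∈ B ∧ k ∈ B ∧
          A ∪ B = V₁ ∪ V₂ ∧ insert s(i, j) (F₁ ∪ F₂) = insert s(r, k) (E₁ ∪ E₂) := by
      intro V₁ V₂ F₁ F₂ i j v hd t₁ t₂ hi hj hr hv hrv ih
      rcases mem_union.1 hv with hv1 | hv2
      · obtain ⟨A, B, E₁, E₂, k, hAB, hA, hB, hrA, hvB, hkB, rfl, rfl⟩ := ih hr hv1 hrv
        rw [disjoint_union_left] at hd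
        rcases mem_union.1 hi with hi | hi
        · refine ⟨A ∪ V₂, B, _, E₂, k, disjoint_union_left.2 ⟨hAB, hd.2.symm⟩,
            .join hd.1 hA t₂ hi hj, hB, mem_union_left _ hrA, hvB, hkB, ?_, ?_⟩
          · rw [union_right_comm]
          · ext; simp; tauto
        · refine ⟨A, B ∪ V₂, E₁, _, k, disjoint_union_right.2 ⟨hAB, hd.1⟩, hA,
            .join hd.2 hB t₂ hi hj, hrA, mem_union_left _ hvB, mem_union_left _ hkB, ?_, ?_⟩
          · rw [union_assoc]
          · ext; simp; tauto
      · by_cases hri : r = i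
        · subst hri
          exact ⟨V₁, V₂, F₁, F₂, j, hd, t₁, t₂, hr, hv2, hj, rfl, rfl⟩
        · obtain ⟨A, B, E₁, E₂, k, hAB, hA, hB, hrA, hiB, hkB, rfl, rfl⟩ := ih hr hi hri
          rw [disjoint_union_left] at hd
          refine ⟨A, B ∪ V₂, E₁, _, k, disjoint_union_right.2 ⟨hAB, hd.1⟩, hA,
            .join hd.2 hB t₂ hiB hj, hrA, mem_union_right _ hv2, mem_union_left _ hkB, ?_, ?_⟩
          · rw [union_assoc]
          · ext; simp; tauto
    rcases mem_union.1 hr with hr1 | hr2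
    · exact main hd t₁ t₂ hi hj hr1 hv hrv ih₁
    · obtain ⟨A, B, E₁, E₂, k, h1, h2, h3, h4, h5, h6, h7, h8⟩ :=
        main hd.symm t₂ t₁ hj hi hr2 (by rwa [union_comm]) hrv ih₂
      exact ⟨A, B, E₁, E₂, k, h1, h2, h3, h4, h5, h6, by rw [h7, union_comm],
        by rw [← h8, Sym2.eq_swap, union_comm F₁]⟩

section TreeSum

variable {R : Type*} [CommSemiring R]

open Classical in
/-- The edge sets of the trees with vertex set `V`. -/
def trees (V : Finset ι) : Finset (Finset (Sym2 ι)) := (edges V).powerset.filter (TreeOn V)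

theorem mem_trees {V : Finset ι} {E : Finset (Sym2 ι)} : E ∈ trees V ↔ TreeOn V E := by
  simp only [trees, mem_filter, mem_powerset, and_iff_right_iff_imp]
  exact fun h => h.subset_edges

/-- The sum over the trees on `V` of the product of `w` over the edges. -/
def treeSum (w : Sym2 ι → R) (V : Finset ι) : R := ∑ E ∈ trees V, ∏ e ∈ E, w e

@[simp]
theorem trees_singleton (v : ι) : trees {v} = {∅} := by
  ext E
  simp only [mem_trees, mem_singleton]
  constructor
  · intro h
    simpa using h.subset_edges
  · rintro rfl
    exact .single v

@[simp]
theorem treeSum_singleton (w : Sym2 ι → R) (v : ι) : treeSum w {v} = 1 := by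
  simp [treeSum]

variable [PartialOrder R] [IsOrderedRing R]

theorem treeSum_nonneg {w : Sym2 ι → R} (hw : ∀ e, 0 ≤ w e) (V : Finset ι) :
    0 ≤ treeSum w V :=
  sum_nonneg fun _ _ => prod_nonneg fun _ _ => hw _

theorem treeSum_mono {w w' : Sym2 ι → R} (hw : ∀ e, 0 ≤ w e) {V : Finset ι}
    (h : ∀ e ∈ edges V, w e ≤ w' e) : treeSum w V ≤ treeSum w' V :=
  sum_le_sum fun _ hE => prod_le_prod (fun _ _ => hw _)
    fun _ he => h _ ((mem_trees.1 hE).subset_edges he)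

/-- Splitting trees at the first edge of the path from `r` to `v`. -/
theorem treeSum_insert_insert_le {w : Sym2 ι → R} (hw : ∀ e, 0 ≤ w e) {r v : ι} {V : Finset ι}
    (hr : r ∉ V) (hv : v ∉ V) (hrv : r ≠ v) :
    treeSum w (insert r (insert v V)) ≤ ∑ S ∈ V.powerset,
      (∑ j ∈ insert v S, w s(r, j)) * treeSum w (insert v S) * treeSum w (insert r (V \ S)) := by
  classical
  have key : ∀ E, TreeOn (insert r (insert v V)) E →
      ∃ p : (_ : Finset ι) × (_ : ι) × (_ : Finset (Sym2 ι)) × Finset (Sym2 ι),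
        p.1 ⊆ V ∧ p.2.1 ∈ insert v p.1 ∧ TreeOn (insert v p.1) p.2.2.1 ∧
        TreeOn (insert r (V \ p.1)) p.2.2.2 ∧ E = insert s(r, p.2.1) (p.2.2.2 ∪ p.2.2.1) := by
    intro E hE
    obtain ⟨A, B, E₁, E₂, j, hd, hA, hB, hrA, hvB, hjB, hAB, rfl⟩ :=
      hE.exists_split (mem_insert_self r _) (mem_insert_of_mem (mem_insert_self v V)) hrv
    have hrB : r ∉ B := disjoint_left.1 hd hrA
    have hBV : B.erase v ⊆ V := by
      intro x hx
      obtain ⟨h1, h2⟩ := mem_erase.1 hx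
      have : x ∈ insert r (insert v V) := hAB ▸ mem_union_right _ h2
      simp only [mem_insert] at this
      rcases this with rfl | rfl | h
      · exact absurd h2 hrB
      · exact absurd rfl h1
      · exact h
    have hA' : insert r (V \ B.erase v) = A := by
      ext x
      have hx := Finset.ext_iff.1 hAB x
      simp only [mem_union, mem_insert, mem_sdiff, mem_erase] at hx ⊢
      constructor
      · rintro (rfl | ⟨h1, h2⟩)
        · exact hrA
        · have : x ≠ v := fun h => hv (h ▸ h1)
          exact (hx.2 (Or.inr (Or.inr h1))).resolve_right fun h => h2 ⟨this, h⟩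
      · intro h
        have hxB : x ∉ B := disjoint_left.1 hd h
        rcases hx.1 (Or.inl h) with h1 | rfl | h1
        · exact Or.inl h1
        · exact absurd hvB hxB
        · exact Or.inr ⟨h1, fun h2 => hxB h2.2⟩
    refine ⟨⟨B.erase v, j, E₂, E₁⟩, hBV, ?_, ?_, ?_, rfl⟩
    · simpa [insert_erase hvB] using hjB
    · simpa [insert_erase hvB] using hB
    · simpa [hA'] using hA
  have : Nonempty ((_ : Finset ι) × (_ : ι) × (_ : Finset (Sym2 ι)) × Finset (Sym2 ι)) :=
    ⟨⟨∅, v, ∅, ∅⟩⟩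
  choose! F hF using key
  simp only [treeSum, sum_mul, mul_sum, sum_sigma']
  refine sum_le_sum_of_injOn
    (fun E => ⟨(F E).1, (F E).2.2.2, (F E).2.2.1, (F E).2.1⟩) ?_ ?_ ?_ ?_
  · intro E hE
    have := hF E (mem_trees.1 hE)
    simp only [mem_sigma, mem_powerset, mem_trees]
    tauto
  · intro E hE E' hE' h
    rw [(hF E (mem_trees.1 hE)).2.2.2.2, (hF E' (mem_trees.1 hE')).2.2.2.2]
    simp only [Sigma.mk.injEq, heq_eq_eq] at h
    rw [h.2.1, h.2.2.1, h.2.2.2]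
  · intro E hE
    obtain ⟨h1, h2, h3, h4, h5⟩ := hF E (mem_trees.1 hE)
    have hd : Disjoint (insert r (V \ (F E).1)) (insert v (F E).1) := by
      rw [disjoint_insert_left, mem_insert]
      refine ⟨fun h => h.elim hrv fun h => hr (h1 h), ?_⟩
      exact (disjoint_insert_sdiff hv).symm
    have hn := mk_notMem_union hd h4.subset_edges h3.subset_edges (mem_insert_self r _) h2
    conv_lhs => rw [h5]
    rw [prod_insert hn, prod_union ((disjoint_edges hd).mono h4.subset_edges h3.subset_edges)]
    apply le_of_eq
    ring
  · intro p _
    exact mul_nonneg (mul_nonneg (hw _) (prod_nonneg fun _ _ => hw _)) (prod_nonneg fun _ _ => hw _)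

/-- Joining two trees by a marked edge. -/
theorem sum_mul_treeSum_mul_treeSum_le {w m : Sym2 ι → R} (hw : ∀ e, 0 ≤ w e) (hm : ∀ e, 0 ≤ m e)
    {v : ι} {V : Finset ι} (hv : v ∉ V) :
    ∑ S ∈ V.powerset, (∑ i ∈ insert v S, ∑ j ∈ V \ S, m s(i, j)) *
        (treeSum w (insert v S) * treeSum w (V \ S)) ≤
      ∑ E ∈ trees (insert v V), ∑ e ∈ E, m e * ∏ f ∈ E.erase e, w f := by
  classical
  simp only [treeSum, sum_mul_sum, sum_sigma']
  refine sum_le_sum_of_injOn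
    (fun p => ⟨insert s(p.2.1.1, p.2.1.2) (p.2.2.1 ∪ p.2.2.2), s(p.2.1.1, p.2.1.2)⟩) ?_ ?_ ?_ ?_
  · rintro ⟨S, ⟨i, j⟩, E₁, E₂⟩ h
    simp only [mem_sigma, mem_powerset, mem_trees] at h ⊢
    refine ⟨?_, mem_insert_self _ _⟩
    have := TreeOn.join (disjoint_insert_sdiff hv) h.2.2.1 h.2.2.2 h.2.1.1 h.2.1.2
    rwa [insert_union, union_sdiff_of_subset h.1] at this
  · rintro ⟨S, ⟨i, j⟩, E₁, E₂⟩ h ⟨S', ⟨i', j'⟩, E₁', E₂'⟩ h' heq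
    simp only [coe_sigma, Set.mem_sigma_iff, mem_coe, mem_powerset, mem_trees] at h h'
    simp only [Sigma.mk.injEq, heq_eq_eq] at heq
    obtain ⟨hE, he⟩ := heq
    have hd := disjoint_insert_sdiff (S := S) hv
    have hd' := disjoint_insert_sdiff (S := S') hv
    have s₁ := h.2.2.1.subset_edges
    have s₂ := h.2.2.2.subset_edges
    have s₁' := h'.2.2.1.subset_edges
    have s₂' := h'.2.2.2.subset_edges
    have hu : E₁ ∪ E₂ = E₁' ∪ E₂' := by
      have := congrArg (fun E => E.erase s(i, j)) hE
      rw [erase_insert (mk_notMem_union hd s₁ s₂ h.2.1.1 h.2.1.2), he,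
        erase_insert (mk_notMem_union hd' s₁' s₂' h'.2.1.1 h'.2.1.2)] at this
      exact this
    have h1 := ConnOn.subset_of_union hd' s₁' s₂' (mem_insert_self v S)
      (mem_insert_self v S') h.2.2.1.connOn hu
    have h2 := ConnOn.subset_of_union hd s₁ s₂ (mem_insert_self v S')
      (mem_insert_self v S) h'.2.2.1.connOn hu.symm
    have hS : S = S' := by
      have := congrArg (fun T => T.erase v) (h1.antisymm h2)
      simpa [erase_insert (fun h0 => hv (h.1 h0)), erase_insert (fun h0 => hv (h'.1 h0))] using this
    subst hS
    have e1 : E₁ = E₁' := by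
      rw [left_eq_inter_edges hd s₁ s₂, hu, ← left_eq_inter_edges hd s₁' s₂']
    have e2 : E₂ = E₂' := by
      rw [right_eq_inter_edges hd s₁ s₂, hu, ← right_eq_inter_edges hd s₁' s₂']
    rcases Sym2.eq_iff.1 he with ⟨rfl, rfl⟩ | ⟨rfl, rfl⟩
    · rw [e1, e2]
    · exact absurd h'.2.1.2 (disjoint_left.1 hd h.2.1.1)
  · rintro ⟨S, ⟨i, j⟩, E₁, E₂⟩ h
    simp only [mem_sigma, mem_powerset, mem_trees] at h ⊢
    have hd := disjoint_insert_sdiff (S := S) hv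
    rw [erase_insert (mk_notMem_union hd h.2.2.1.subset_edges h.2.2.2.subset_edges
      h.2.1.1 h.2.1.2),
      prod_union ((disjoint_edges hd).mono h.2.2.1.subset_edges h.2.2.2.subset_edges)]
  · rintro ⟨E, e⟩ _
    exact mul_nonneg (hm _) (prod_nonneg fun _ _ => hw _)

end TreeSum

end Combinatorics

end ClusterExpansion

end

noncomputable section

namespace ClusterExpansion

open Finset

section KirkwoodSalsburg

variable {ι : Type*} [DecidableEq ι]

/-- Forests with set of roots `W` and set of other vertices `V`, one tree for each root. A forest is
built by adding a root `k` whose children `S` were roots before. -/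
inductive ForestOn : Finset ι → Finset ι → Finset (Sym2 ι) → Prop
  | empty : ForestOn ∅ ∅ ∅
  | step {W S V : Finset ι} {E : Finset (Sym2 ι)} {k : ι} (hkW : k ∉ W) (hkS : k ∉ S) (hkV : k ∉ V)
      (hWS : Disjoint W S) (hV : Disjoint (W ∪ S) V) (h : ForestOn (W ∪ S) V E) :
      ForestOn (insert k W) (S ∪ V) (S.image (fun j => s(k, j)) ∪ E)

theorem ForestOn.subset_edges {W V : Finset ι} {E : Finset (Sym2 ι)} (h : ForestOn W V E) :
    E ⊆ edges (W ∪ V) := by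
  induction h with
  | empty => simp
  | @step W S V E k hkW hkS hkV hWS hV h ih =>
    rw [union_assoc] at ih
    rw [insert_union, edges_insert (by simp [hkW, hkS, hkV])]
    refine union_subset_union (image_subset_image fun x hx => ?_) ih
    simp [hx]

/-- Attaching leaves to a vertex of a tree. -/
theorem TreeOn.union_leaves {Q : Finset ι} {E : Finset (Sym2 ι)} (h : TreeOn Q E) {k : ι}
    (hk : k ∈ Q) {S : Finset ι} (hS : Disjoint Q S) :
    TreeOn (Q ∪ S) (S.image (fun j => s(k, j)) ∪ E) := by
  induction S using Finset.induction_on with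
  | empty => simpa
  | insert a S ha ih =>
    rw [disjoint_insert_right] at hS
    have := TreeOn.join (disjoint_singleton_right.2 (by simp [hS.1, ha])) (ih hS.2) (.single a)
      (mem_union_left _ hk) (mem_singleton_self a)
    convert this using 1
    · rw [union_insert, union_singleton]
    · rw [image_insert, insert_union, union_empty]

/-- Attaching a forest to a tree that contains its roots. -/
theorem ForestOn.treeOn_union {W V : Finset ι} {E : Finset (Sym2 ι)} (h : ForestOn W V E)
    {Q : Finset ι} {E₀ : Finset (Sym2 ι)} (hQ : TreeOn Q E₀) (hWQ : W ⊆ Q) (hQV : Disjoint Q V) :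
    TreeOn (Q ∪ V) (E ∪ E₀) := by
  induction h generalizing Q E₀ with
  | empty => simpa
  | @step W S V E k hkW hkS hkV hWS hV h ih =>
    rw [insert_subset_iff] at hWQ
    rw [disjoint_union_right] at hQV
    have := ih (hQ.union_leaves hWQ.1 hQV.1) (union_subset_union_left hWQ.2)
      (disjoint_union_left.2 ⟨hQV.2, hV.mono_left subset_union_right⟩)
    rwa [union_assoc, ← union_assoc E, union_comm E] at this

open Classical in
/-- The edge sets of the forests with set of roots `W` and set of other vertices `V`. -/
def forests (W V : Finset ι) : Finset (Finset (Sym2 ι)) :=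
  (edges (W ∪ V)).powerset.filter (ForestOn W V)

theorem mem_forests {W V : Finset ι} {E : Finset (Sym2 ι)} :
    E ∈ forests W V ↔ ForestOn W V E := by
  simp only [forests, mem_filter, mem_powerset, and_iff_right_iff_imp]
  exact fun h => h.subset_edges

/-- The sum over the forests rooted in `W` of the product of `w` over the edges. -/
def forestSum (w : Sym2 ι → ℝ) (W V : Finset ι) : ℝ := ∑ E ∈ forests W V, ∏ e ∈ E, w e

theorem forestSum_nonneg {w : Sym2 ι → ℝ} (hw : ∀ e, 0 ≤ w e) (W V : Finset ι) :
    0 ≤ forestSum w W V :=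
  sum_nonneg fun _ _ => prod_nonneg fun _ _ => hw _

theorem one_le_forestSum_empty {w : Sym2 ι → ℝ} (hw : ∀ e, 0 ≤ w e) : 1 ≤ forestSum w ∅ ∅ := by
  have := single_le_sum (f := fun E => ∏ e ∈ E, w e) (fun E _ => prod_nonneg fun _ _ => hw _)
    (mem_forests.2 (ForestOn.empty (ι := ι)))
  simpa [forestSum] using this

theorem forestSum_singleton_le {w : Sym2 ι → ℝ} (hw : ∀ e, 0 ≤ w e) {r : ι} {V : Finset ι}
    (hr : r ∉ V) : forestSum w {r} V ≤ treeSum w (insert r V) := by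
  refine sum_le_sum_of_subset_of_nonneg (fun E hE => mem_trees.2 ?_)
    fun E _ _ => prod_nonneg fun _ _ => hw _
  have := (mem_forests.1 hE).treeOn_union (.single r) subset_rfl (disjoint_singleton_left.2 hr)
  rwa [← insert_eq, union_empty] at this

theorem sum_prod_mul_forestSum_le {w : Sym2 ι → ℝ} (hw : ∀ e, 0 ≤ w e) {k : ι} {W V : Finset ι}
    (hkW : k ∉ W) (hkV : k ∉ V) (hWV : Disjoint W V) :
    ∑ S ∈ V.powerset, (∏ j ∈ S, w s(k, j)) * forestSum w (W ∪ S) (V \ S) ≤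
      forestSum w (insert k W) V := by
  simp only [forestSum, mul_sum, sum_sigma']
  have hkE : ∀ {S E}, S ⊆ V → ForestOn (W ∪ S) (V \ S) E → ∀ j, s(k, j) ∉ E := by
    intro S E hS hE j hj
    have := (mk_mem_edges.1 (hE.subset_edges hj)).1
    rw [union_assoc, union_sdiff_of_subset hS] at this
    simp [hkW, hkV] at this
  have hrec : ∀ {S E}, S ⊆ V → ForestOn (W ∪ S) (V \ S) E →
      ∀ j, s(k, j) ∈ S.image (fun j => s(k, j)) ∪ E ↔ j ∈ S := by
    intro S E hS hE j
    rw [mem_union, or_iff_left (hkE hS hE j), mem_image]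
    constructor
    · rintro ⟨i, hi, h⟩
      rwa [← Sym2.congr_right.1 h]
    · exact fun h => ⟨j, h, rfl⟩
  have hdisj : ∀ {S E}, S ⊆ V → ForestOn (W ∪ S) (V \ S) E →
      Disjoint (S.image (fun j => s(k, j))) E := by
    intro S E hS hE
    rw [disjoint_left]
    intro e he
    obtain ⟨j, -, rfl⟩ := mem_image.1 he
    exact hkE hS hE j
  refine sum_le_sum_of_injOn (fun p => p.1.image (fun j => s(k, j)) ∪ p.2) ?_ ?_ ?_ ?_
  · rintro ⟨S, E⟩ h
    simp only [mem_sigma, mem_powerset, mem_forests] at h ⊢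
    have := ForestOn.step hkW (fun h0 => hkV (h.1 h0)) (fun h0 => hkV (mem_sdiff.1 h0).1)
      (hWV.mono_right h.1)
      (disjoint_union_left.2 ⟨hWV.mono_right sdiff_subset, disjoint_sdiff⟩) h.2
    rwa [union_sdiff_of_subset h.1] at this
  · rintro ⟨S, E⟩ h ⟨S', E'⟩ h' heq
    simp only [coe_sigma, Set.mem_sigma_iff, mem_coe, mem_powerset, mem_forests] at h h' heq
    have hS : S = S' := by
      ext j
      rw [← hrec h.1 h.2, ← hrec h'.1 h'.2, heq]
    subst hS
    have : E = E' := by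
      rw [← union_sdiff_cancel_left (hdisj h.1 h.2), heq,
        union_sdiff_cancel_left (hdisj h.1 h'.2)]
    rw [this]
  · rintro ⟨S, E⟩ h
    simp only [mem_sigma, mem_powerset, mem_forests] at h
    rw [prod_union (hdisj h.1 h.2), prod_image (injective_mk_left k).injOn]
  · exact fun E _ => prod_nonneg fun _ _ => hw _

theorem sum_powerset_powerset_comm {R : Type*} [AddCommMonoid R] (V : Finset ι)
    (f : Finset ι → Finset ι → Finset ι → R) :
    ∑ Q ∈ V.powerset, ∑ S ∈ Q.powerset, f S (Q \ S) (V \ Q) =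
      ∑ S ∈ V.powerset, ∑ T ∈ (V \ S).powerset, f S T ((V \ S) \ T) := by
  simp only [sum_sigma']
  refine sum_bij' (fun p _ => ⟨p.2, p.1 \ p.2⟩) (fun p _ => ⟨p.1 ∪ p.2, p.1⟩) ?_ ?_ ?_ ?_ ?_
  · rintro ⟨Q, S⟩ h
    simp only [mem_sigma, mem_powerset] at h ⊢
    exact ⟨h.2.trans h.1, sdiff_subset_sdiff h.1 subset_rfl⟩
  · rintro ⟨S, T⟩ h
    simp only [mem_sigma, mem_powerset] at h ⊢
    exact ⟨union_subset h.1 (h.2.trans sdiff_subset), subset_union_left⟩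
  · rintro ⟨Q, S⟩ h
    simp only [mem_sigma, mem_powerset] at h ⊢
    rw [union_sdiff_of_subset h.2]
  · rintro ⟨S, T⟩ h
    simp only [mem_sigma, mem_powerset] at h ⊢
    rw [union_sdiff_cancel_left (disjoint_sdiff.mono_right h.2)]
  · rintro ⟨Q, S⟩ h
    simp only [mem_sigma, mem_powerset] at h ⊢
    rw [sdiff_sdiff_left, sup_eq_union, union_sdiff_of_subset h.2]

variable {R : Type*} [CommRing R]

/-- A convolution equation determines its solution. -/
theorem eq_of_sum_powerset_mul_eq {F f g : Finset ι → R} (hF : F ∅ = 1) (V : Finset ι)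
    (h : ∀ Q ⊆ V, ∑ S ∈ Q.powerset, f S * F (Q \ S) = ∑ S ∈ Q.powerset, g S * F (Q \ S)) :
    f V = g V := by
  induction V using Finset.strongInduction with
  | H V ih =>
    have hV := h V subset_rfl
    rw [← insert_erase (mem_powerset_self V), sum_insert (notMem_erase _ _),
      sum_insert (notMem_erase _ _), sdiff_self, bot_eq_empty, hF, mul_one, mul_one] at hV
    have : ∀ S ∈ V.powerset.erase V, f S * F (V \ S) = g S * F (V \ S) := by
      intro S hS
      obtain ⟨h1, h2⟩ := mem_erase.1 hS
      rw [ih S ((mem_powerset.1 h2).ssubset_of_ne h1)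
        fun Q hQ => h Q (hQ.trans (mem_powerset.1 h2))]
    rw [sum_congr rfl this] at hV
    exact add_right_cancel hV

/-- The sum over the graphs on `W ∪ V` all of whose connected components meet `W`, as determined
by its convolution with `fullProd`. -/
def rootedSum (ζ : Sym2 ι → R) (W V : Finset ι) : R :=
  fullProd ζ (W ∪ V) - ∑ S ∈ V.ssubsets.attach, rootedSum ζ W S.1 * fullProd ζ (V \ S.1)
termination_by V.card
decreasing_by exact card_lt_card (mem_ssubsets.1 S.2)

theorem sum_rootedSum_mul_fullProd (ζ : Sym2 ι → R) (W V : Finset ι) :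
    ∑ S ∈ V.powerset, rootedSum ζ W S * fullProd ζ (V \ S) = fullProd ζ (W ∪ V) := by
  have h : rootedSum ζ W V = fullProd ζ (W ∪ V) -
      ∑ S ∈ V.ssubsets, rootedSum ζ W S * fullProd ζ (V \ S) := by
    rw [rootedSum, sum_attach _ fun S => rootedSum ζ W S * fullProd ζ (V \ S)]
  rw [← insert_erase (mem_powerset_self V), sum_insert (notMem_erase _ _), h, ssubsets]
  simp

theorem rootedSum_singleton (ζ : Sym2 ι → R) {r : ι} {V : Finset ι} (hr : r ∉ V) :
    rootedSum ζ {r} V = connSum ζ (insert r V) := by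
  refine eq_of_sum_powerset_mul_eq (F := fullProd ζ) (f := rootedSum ζ {r})
    (g := fun S => connSum ζ (insert r S)) (fullProd_empty ζ) V fun Q hQ => ?_
  rw [sum_rootedSum_mul_fullProd, ← insert_eq, fullProd_insert ζ fun h => hr (hQ h)]

theorem rootedSum_empty_left (ζ : Sym2 ι → R) (V : Finset ι) :
    rootedSum ζ ∅ V = if V = ∅ then 1 else 0 := by
  refine eq_of_sum_powerset_mul_eq (F := fullProd ζ) (f := rootedSum ζ ∅)
    (g := fun S => if S = ∅ then 1 else 0) (fullProd_empty ζ) V fun Q hQ => ?_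
  rw [sum_rootedSum_mul_fullProd]
  simp

theorem fullProd_insert' (ζ : Sym2 ι → R) {k : ι} {W : Finset ι} (hk : k ∉ W) :
    fullProd ζ (insert k W) = (∏ j ∈ W, (1 + ζ s(k, j))) * fullProd ζ W :=
  prod_edges_insert hk _

/-- The Kirkwood–Salsburg recursion. -/
theorem rootedSum_insert (ζ : Sym2 ι → R) {k : ι} {W V : Finset ι} (hkW : k ∉ W) (hkV : k ∉ V)
    (hWV : Disjoint W V) : rootedSum ζ (insert k W) V = (∏ j ∈ W, (1 + ζ s(k, j))) *
      ∑ S ∈ V.powerset, (∏ j ∈ S, ζ s(k, j)) * rootedSum ζ (W ∪ S) (V \ S) := by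
  refine eq_of_sum_powerset_mul_eq (F := fullProd ζ) (f := rootedSum ζ (insert k W))
    (g := fun Q => (∏ j ∈ W, (1 + ζ s(k, j))) *
      ∑ S ∈ Q.powerset, (∏ j ∈ S, ζ s(k, j)) * rootedSum ζ (W ∪ S) (Q \ S))
    (fullProd_empty ζ) V fun Q hQ => ?_
  have h := sum_powerset_powerset_comm Q fun S T U =>
    (∏ j ∈ S, ζ s(k, j)) * rootedSum ζ (W ∪ S) T * fullProd ζ U
  have hkQ : k ∉ Q := fun h => hkV (hQ h)
  simp only [mul_assoc, sum_mul, ← mul_sum] at h ⊢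
  rw [h, sum_rootedSum_mul_fullProd, insert_union,
    fullProd_insert' ζ (by simp [hkW, hkQ]), prod_union (hWV.mono_right hQ),
    mul_assoc, prod_one_add (s := Q), sum_mul]
  congr 1
  refine sum_congr rfl fun S hS => ?_
  rw [sum_rootedSum_mul_fullProd, union_assoc, union_sdiff_of_subset (mem_powerset.1 hS)]

theorem prod_prod_erase_eq_sq (f : Sym2 ι → ℝ) (W : Finset ι) :
    ∏ k ∈ W, ∏ j ∈ W.erase k, f s(k, j) = (∏ e ∈ edges W, f e) ^ 2 := by
  induction W using Finset.induction_on with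
  | empty => simp
  | insert a W ha ih =>
    rw [prod_insert ha, erase_insert ha, prod_edges_insert ha, mul_pow, ← ih]
    have : ∀ k ∈ W, ∏ j ∈ (insert a W).erase k, f s(k, j) =
        f s(a, k) * ∏ j ∈ W.erase k, f s(k, j) := by
      intro k hk
      have hak : a ≠ k := fun h => ha (h ▸ hk)
      rw [erase_insert_of_ne hak, prod_insert (fun h => ha (mem_of_mem_erase h)), Sym2.eq_swap]
    rw [prod_congr rfl this, prod_mul_distrib]
    ring

theorem exists_prod_erase_le (f : Sym2 ι → ℝ) (hf : ∀ e, 0 ≤ f e) (b : ι → ℝ) {W : Finset ι}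
    (hW : W.Nonempty) (h : ∏ e ∈ edges W, f e ≤ ∏ i ∈ W, Real.exp (b i)) :
    ∃ k ∈ W, ∏ j ∈ W.erase k, f s(k, j) ≤ Real.exp (2 * b k) := by
  by_contra! hcon
  have h1 : ∏ k ∈ W, Real.exp (2 * b k) < ∏ k ∈ W, ∏ j ∈ W.erase k, f s(k, j) :=
    prod_lt_prod_of_nonempty (fun _ _ => Real.exp_pos _) hcon hW
  rw [prod_prod_erase_eq_sq] at h1
  have h2 : ∏ k ∈ W, Real.exp (2 * b k) = (∏ i ∈ W, Real.exp (b i)) ^ 2 := by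
    rw [← prod_pow]
    exact prod_congr rfl fun k _ => by rw [← Real.exp_nat_mul]; norm_num
  rw [h2] at h1
  exact absurd h1 (not_lt.2 (pow_le_pow_left₀ (prod_nonneg fun _ _ => hf _) h 2))

variable {ζ : Sym2 ι → ℂ} {b : ι → ℝ}

theorem norm_rootedSum_le
    (hst : ∀ V : Finset ι, ∏ e ∈ edges V, ‖1 + ζ e‖ ≤ ∏ i ∈ V, Real.exp (b i))
    {W V : Finset ι} (hWV : Disjoint W V) :
    ‖rootedSum ζ W V‖ ≤
      (∏ i ∈ W ∪ V, Real.exp (2 * b i)) * forestSum (fun e => ‖ζ e‖) W V := by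
  induction hn : (W ∪ V).card generalizing W V with
  | zero =>
    obtain ⟨rfl, rfl⟩ := union_eq_empty.1 (card_eq_zero.1 hn)
    simpa [rootedSum_empty_left] using one_le_forestSum_empty (ι := ι) fun e => norm_nonneg (ζ e)
  | succ n ih =>
    have hnn : ∀ e, 0 ≤ ‖ζ e‖ := fun e => norm_nonneg _
    rcases W.eq_empty_or_nonempty with rfl | hW
    · have : V ≠ ∅ := by rintro rfl; simp at hn
      simp only [rootedSum_empty_left, this, if_false, norm_zero]
      exact mul_nonneg (prod_nonneg fun _ _ => (Real.exp_pos _).le) (forestSum_nonneg hnn _ _)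
    obtain ⟨k, hk, hkb⟩ := exists_prod_erase_le (fun e => ‖1 + ζ e‖) (fun _ => norm_nonneg _) b hW
      (hst W)
    obtain ⟨W, hkW, rfl⟩ : ∃ W', k ∉ W' ∧ insert k W' = W :=
      ⟨W.erase k, notMem_erase _ _, insert_erase hk⟩
    rw [erase_insert hkW] at hkb
    rw [disjoint_insert_left] at hWV
    have hkWV : k ∉ W ∪ V := by simp [hkW, hWV.1]
    rw [insert_union, card_insert_of_notMem hkWV, add_left_inj] at hn
    rw [rootedSum_insert ζ hkW hWV.1 hWV.2, norm_mul, norm_prod, insert_union, prod_insert hkWV,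
      mul_assoc]
    refine mul_le_mul hkb ?_ (norm_nonneg _) (Real.exp_pos _).le
    calc ‖∑ S ∈ V.powerset, (∏ j ∈ S, ζ s(k, j)) * rootedSum ζ (W ∪ S) (V \ S)‖
        ≤ ∑ S ∈ V.powerset, (∏ j ∈ S, ‖ζ s(k, j)‖) * ((∏ i ∈ W ∪ V, Real.exp (2 * b i)) *
            forestSum (fun e => ‖ζ e‖) (W ∪ S) (V \ S)) := by
          refine norm_sum_le_of_le _ fun S hS => ?_
          rw [norm_mul, norm_prod]
          refine mul_le_mul_of_nonneg_left ?_ (prod_nonneg fun _ _ => norm_nonneg _)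
          have hu : W ∪ S ∪ V \ S = W ∪ V := by
            rw [union_assoc, union_sdiff_of_subset (mem_powerset.1 hS)]
          have := ih (W := W ∪ S) (V := V \ S)
            (disjoint_union_left.2 ⟨hWV.2.mono_right sdiff_subset, disjoint_sdiff⟩)
            (by rw [hu, hn])
          rwa [hu] at this
      _ = (∏ i ∈ W ∪ V, Real.exp (2 * b i)) * ∑ S ∈ V.powerset, (∏ j ∈ S, ‖ζ s(k, j)‖) *
            forestSum (fun e => ‖ζ e‖) (W ∪ S) (V \ S) := by
          rw [mul_sum]
          exact sum_congr rfl fun _ _ => by ring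
      _ ≤ _ := mul_le_mul_of_nonneg_left (sum_prod_mul_forestSum_le hnn hkW hWV.1 hWV.2)
          (prod_nonneg fun _ _ => (Real.exp_pos _).le)

/-- Tree-graph inequality for stable interactions, in terms of `ζ`. -/
theorem norm_connSum_le_treeSum_zeta
    (hst : ∀ V : Finset ι, ∏ e ∈ edges V, ‖1 + ζ e‖ ≤ ∏ i ∈ V, Real.exp (b i))
    {V : Finset ι} (hV : V.Nonempty) :
    ‖connSum ζ V‖ ≤ (∏ i ∈ V, Real.exp (2 * b i)) * treeSum (fun e => ‖ζ e‖) V := by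
  obtain ⟨r, hr⟩ := hV
  obtain ⟨V, hrV, rfl⟩ : ∃ V', r ∉ V' ∧ insert r V' = V :=
    ⟨V.erase r, notMem_erase _ _, insert_erase hr⟩
  rw [← rootedSum_singleton ζ hrV]
  have := norm_rootedSum_le hst (disjoint_singleton_left.2 hrV)
  rw [← insert_eq] at this
  exact this.trans (mul_le_mul_of_nonneg_left
    (forestSum_singleton_le (fun e => norm_nonneg _) hrV)
    (prod_nonneg fun _ _ => (Real.exp_pos _).le))

end KirkwoodSalsburg

end ClusterExpansion

end

noncomputable section

namespace ClusterExpansion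

open Finset

section Interpolation

variable {ι : Type*} [DecidableEq ι]

theorem sum_mul_connSum_mul_fullProd {R : Type*} [CommRing R] (ζ : Sym2 ι → R) (x : ι → R)
    (V : Finset ι) : ∑ T ∈ V.powerset, (∑ j ∈ T, x j) * (connSum ζ T * fullProd ζ (V \ T)) =
      (∑ j ∈ V, x j) * fullProd ζ V := by
  have h1 : ∀ T ∈ V.powerset, (∑ j ∈ T, x j) * (connSum ζ T * fullProd ζ (V \ T)) =
      ∑ j ∈ V, x j * if j ∈ T then connSum ζ T * fullProd ζ (V \ T) else 0 := by
    intro T hT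
    rw [sum_mul]
    refine sum_subset_zero_on_sdiff (mem_powerset.1 hT) ?_ ?_
    · intro j hj
      simp [(mem_sdiff.1 hj).2]
    · intro j hj
      simp [hj]
  rw [sum_congr rfl h1, sum_comm, sum_mul]
  refine sum_congr rfl fun j hj => ?_
  obtain ⟨W, hjW, rfl⟩ : ∃ W, j ∉ W ∧ insert j W = V :=
    ⟨V.erase j, notMem_erase _ _, insert_erase hj⟩
  rw [← mul_sum, sum_powerset_insert hjW, fullProd_insert ζ hjW]
  congr 1
  have h2 : ∀ T ∈ W.powerset, (if j ∈ T then connSum ζ T * fullProd ζ (insert j W \ T) else 0) = 0 :=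
    fun T hT => if_neg fun h => hjW (mem_powerset.1 hT h)
  rw [sum_congr rfl h2, sum_const_zero, zero_add]
  refine sum_congr rfl fun T _ => ?_
  rw [if_pos (mem_insert_self _ _), insert_sdiff_insert, sdiff_insert_of_notMem hjW]

/-- The interaction `ζ` of the potential `t * u`. -/
def scaledZeta (u : Sym2 ι → ℂ) (t : ℝ) (e : Sym2 ι) : ℂ := Complex.exp (-(t * u e)) - 1

theorem fullProd_scaledZeta (u : Sym2 ι → ℂ) (t : ℝ) (V : Finset ι) :
    fullProd (scaledZeta u t) V = Complex.exp (-(t * ∑ e ∈ edges V, u e)) := by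
  simp [fullProd, scaledZeta, ← Complex.exp_sum, mul_sum]

theorem hasDerivAt_exp_neg_mul (z : ℂ) (t : ℝ) :
    HasDerivAt (fun t : ℝ => Complex.exp (-(t * z))) (-z * Complex.exp (-(t * z))) t := by
  have h : HasDerivAt (fun t : ℝ => -((t : ℂ) * z)) (-(1 * z)) t :=
    ((Complex.ofRealCLM.hasDerivAt (x := t)).mul_const z).neg
  convert h.cexp using 1
  ring

theorem differentiable_connSum_scaledZeta (u : Sym2 ι → ℂ) (V : Finset ι) :
    Differentiable ℝ fun t => connSum (scaledZeta u t) V := by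
  have : ∀ e, Differentiable ℝ fun t => scaledZeta u t e := fun e t =>
    ((hasDerivAt_exp_neg_mul (u e) t).sub_const 1).differentiableAt
  unfold connSum
  fun_prop

/-- The differential equation for the connected functions of the potential `t * u`. -/
theorem hasDerivAt_connSum_scaledZeta (u : Sym2 ι → ℂ) {v : ι} {V : Finset ι} (hv : v ∉ V)
    (t : ℝ) : HasDerivAt (fun t => connSum (scaledZeta u t) (insert v V))
      (-(∑ e ∈ edges (insert v V), u e) * connSum (scaledZeta u t) (insert v V) -
        ∑ S ∈ V.powerset, (∑ i ∈ insert v S, ∑ j ∈ V \ S, u s(i, j)) *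
          (connSum (scaledZeta u t) (insert v S) * connSum (scaledZeta u t) (V \ S))) t := by
  set F := fullProd (scaledZeta u t) with hF
  set C := connSum (scaledZeta u t) with hC
  set D : Finset ι → ℂ := fun V => deriv (fun t => connSum (scaledZeta u t) V) t with hD
  have hCd : ∀ V, HasDerivAt (fun t => connSum (scaledZeta u t) V) (D V) t := fun V =>
    (differentiable_connSum_scaledZeta u V t).hasDerivAt
  have hFd : ∀ V, HasDerivAt (fun t => fullProd (scaledZeta u t) V)
      (-(∑ e ∈ edges V, u e) * F V) t := by
    intro V
    simp only [hF, fullProd_scaledZeta]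
    exact hasDerivAt_exp_neg_mul _ t
  have key : D (insert v V) + (∑ e ∈ edges (insert v V), u e) * C (insert v V) =
      -∑ S ∈ V.powerset, (∑ i ∈ insert v S, ∑ j ∈ V \ S, u s(i, j)) *
          (C (insert v S) * C (V \ S)) := by
    refine eq_of_sum_powerset_mul_eq (F := F)
      (f := fun V => D (insert v V) + (∑ e ∈ edges (insert v V), u e) * C (insert v V))
      (g := fun V => -∑ S ∈ V.powerset, (∑ i ∈ insert v S, ∑ j ∈ V \ S, u s(i, j)) *
          (C (insert v S) * C (V \ S))) (fullProd_empty _) V fun Q hQ => ?_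
    have hvQ : v ∉ Q := fun h => hv (hQ h)
    have e1 : -(∑ e ∈ edges (insert v Q), u e) * F (insert v Q) =
        ∑ S ∈ Q.powerset, (D (insert v S) * F (Q \ S) +
          C (insert v S) * (-(∑ e ∈ edges (Q \ S), u e) * F (Q \ S))) := by
      refine (hFd (insert v Q)).unique ?_
      simp only [fullProd_insert _ hvQ]
      exact HasDerivAt.fun_sum fun S _ => (hCd _).mul (hFd _)
    rw [hF, fullProd_insert _ hvQ, mul_sum] at e1
    have e2 : ∀ S ∈ Q.powerset, ∑ e ∈ edges (insert v Q), u e = ∑ e ∈ edges (insert v S), u e +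
        ∑ e ∈ edges (Q \ S), u e + ∑ i ∈ insert v S, ∑ j ∈ Q \ S, u s(i, j) := by
      intro S hS
      rw [← sum_edges_union (disjoint_insert_sdiff hvQ), insert_union,
        union_sdiff_of_subset (mem_powerset.1 hS)]
    have e3 := sum_powerset_powerset_comm Q fun S T U =>
      (∑ i ∈ insert v S, ∑ j ∈ T, u s(i, j)) * (C (insert v S) * C T) * F U
    have e4 : ∀ S ∈ Q.powerset, ∑ T ∈ (Q \ S).powerset,
        (∑ i ∈ insert v S, ∑ j ∈ T, u s(i, j)) * (C (insert v S) * C T) * F ((Q \ S) \ T) =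
        (∑ i ∈ insert v S, ∑ j ∈ Q \ S, u s(i, j)) * (C (insert v S) * F (Q \ S)) := by
      intro S _
      have := sum_mul_connSum_mul_fullProd (scaledZeta u t) (fun j => ∑ i ∈ insert v S, u s(i, j))
        (Q \ S)
      rw [← hF] at this
      rw [sum_comm (s := insert v S), mul_left_comm, ← this, mul_sum]
      refine sum_congr rfl fun T _ => ?_
      rw [sum_comm (s := insert v S)]
      ring
    simp only [neg_mul, sum_neg_distrib, sum_mul] at e3 ⊢
    simp only [← sum_mul] at e3 ⊢
    rw [e3, sum_congr rfl e4, eq_neg_iff_add_eq_zero, ← sum_add_distrib]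
    rw [← sub_eq_zero, ← sum_sub_distrib] at e1
    rw [← neg_eq_zero, ← e1, ← sum_neg_distrib]
    refine sum_congr rfl fun S hS => ?_
    rw [e2 S hS]
    ring
  have := hCd (insert v V)
  rwa [show D (insert v V) = -(∑ e ∈ edges (insert v V), u e) * C (insert v V) -
        ∑ S ∈ V.powerset, (∑ i ∈ insert v S, ∑ j ∈ V \ S, u s(i, j)) *
          (C (insert v S) * C (V \ S)) by linear_combination key] at this

theorem connSum_zero {R : Type*} [CommRing R] {V : Finset ι} {i j : ι} (hi : i ∈ V) (hj : j ∈ V)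
    (hij : i ≠ j) : connSum (fun _ => (0 : R)) V = 0 := by
  classical
  rw [connSum]
  refine sum_eq_zero fun E hE => ?_
  rcases E.eq_empty_or_nonempty with rfl | ⟨e, he⟩
  · have := (mem_filter.1 hE).2 {i} (fun _ _ h => by simp at h) i hi j hj rfl
    exact absurd this.symm hij
  · exact prod_eq_zero he rfl

theorem hasDerivAt_treeSum {ω : Sym2 ι → ℝ → ℝ} {ω' : Sym2 ι → ℝ} {t : ℝ}
    (h : ∀ e, HasDerivAt (ω e) (ω' e) t) (V : Finset ι) :
    HasDerivAt (fun t => treeSum (fun e => ω e t) V)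
      (∑ E ∈ trees V, ∑ e ∈ E, ω' e * ∏ f ∈ E.erase e, ω f t) t := by
  refine HasDerivAt.fun_sum fun E _ => ?_
  have := HasDerivAt.fun_finsetProd (u := E) fun e _ => h e
  simpa only [smul_eq_mul, mul_comm] using this

theorem norm_connSum_scaledZeta_le {u : Sym2 ι → ℂ} {κ m : Sym2 ι → ℝ} {ω : Sym2 ι → ℝ → ℝ}
    {b : ι → ℝ} (hκ : ∀ e, 0 ≤ κ e) (hm : ∀ e, ‖u e‖ ≤ m e) (hω : ∀ e t, 0 ≤ t → 0 ≤ ω e t)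
    (hω' : ∀ e t, HasDerivAt (ω e) (m e - κ e * ω e t) t) (hb : ∀ i, 0 ≤ b i)
    (hst : ∀ V : Finset ι, ∑ e ∈ edges V, κ e ≤ ∑ e ∈ edges V, (u e).re + ∑ i ∈ V, b i)
    {V : Finset ι} (hV : V.Nonempty) {t : ℝ} (ht : 0 ≤ t) :
    ‖connSum (scaledZeta u t) V‖ ≤
      Real.exp (t * ∑ i ∈ V, b i) * treeSum (fun e => ω e t) V := by
  induction hn : V.card using Nat.strong_induction_on generalizing V t with
  | _ n ih =>
  obtain ⟨v, hvV⟩ := hV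
  obtain ⟨V, hv, rfl⟩ : ∃ V', v ∉ V' ∧ insert v V' = V :=
    ⟨V.erase v, notMem_erase _ _, insert_erase hvV⟩
  rcases V.eq_empty_or_nonempty with rfl | ⟨k, hk⟩
  · simpa [connSum_singleton] using mul_nonneg ht (hb v)
  rw [card_insert_of_notMem hv] at hn
  set U : ℂ := ∑ e ∈ edges (insert v V), u e with hU
  set α : ℝ := U.re + ∑ i ∈ insert v V, b i with hα
  set y : ℝ → ℝ := fun t => treeSum (fun e => ω e t) (insert v V) with hy
  set y' : ℝ → ℝ := fun t => ∑ E ∈ trees (insert v V), ∑ e ∈ E,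
    (m e - κ e * ω e t) * ∏ f ∈ E.erase e, ω f t with hy'
  set X : ℝ → ℂ := fun t => ∑ S ∈ V.powerset, (∑ i ∈ insert v S, ∑ j ∈ V \ S, u s(i, j)) *
          (connSum (scaledZeta u t) (insert v S) * connSum (scaledZeta u t) (V \ S)) with hX
  have hm0 : ∀ e, 0 ≤ m e := fun e => (norm_nonneg _).trans (hm e)
  have hyd : ∀ t, HasDerivAt y (y' t) t := fun t => hasDerivAt_treeSum (fun e => hω' e t) _
  have hre : U.re = ∑ e ∈ edges (insert v V), (u e).re := by simp [hU]
  -- the bound on the derivative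
  have hX_le : ∀ t, 0 ≤ t → ‖X t‖ ≤ Real.exp (t * ∑ i ∈ insert v V, b i) * (α * y t + y' t) := by
    intro t ht
    calc ‖X t‖ ≤ ∑ S ∈ V.powerset, (∑ i ∈ insert v S, ∑ j ∈ V \ S, m s(i, j)) *
          (Real.exp (t * ∑ i ∈ insert v V, b i) * (treeSum (fun e => ω e t) (insert v S) *
            treeSum (fun e => ω e t) (V \ S))) := by
          refine norm_sum_le_of_le _ fun S hS => ?_
          have hSV := mem_powerset.1 hS
          rcases (V \ S).eq_empty_or_nonempty with h0 | h0
          · simp [h0]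
          have hc : (V \ S).card + (insert v S).card = V.card + 1 := by
            rw [card_insert_of_notMem fun h => hv (hSV h), ← add_assoc, card_sdiff_add_card_eq_card hSV]
          have c1 : 0 < (V \ S).card := card_pos.2 h0
          have c2 : 0 < (insert v S).card := card_pos.2 (insert_nonempty _ _)
          have i1 := ih _ (by omega) (insert_nonempty v S) ht rfl
          have i2 := ih _ (by omega) h0 ht rfl
          rw [norm_mul, norm_mul]
          refine mul_le_mul ?_ ?_ (by positivity) (sum_nonneg fun _ _ => sum_nonneg fun _ _ => hm0 _)
          · exact norm_sum_le_of_le _ fun i _ => norm_sum_le_of_le _ fun j _ => hm _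
          · refine (mul_le_mul i1 i2 (norm_nonneg _) ((norm_nonneg _).trans i1)).trans_eq ?_
            rw [mul_mul_mul_comm, ← Real.exp_add, ← mul_add, ← sum_union (disjoint_insert_sdiff hv),
              insert_union, union_sdiff_of_subset hSV]
      _ = Real.exp (t * ∑ i ∈ insert v V, b i) * ∑ S ∈ V.powerset,
            (∑ i ∈ insert v S, ∑ j ∈ V \ S, m s(i, j)) *
            (treeSum (fun e => ω e t) (insert v S) * treeSum (fun e => ω e t) (V \ S)) := by
          rw [mul_sum V.powerset]
          exact sum_congr rfl fun _ _ => by ring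
      _ ≤ Real.exp (t * ∑ i ∈ insert v V, b i) * ∑ E ∈ trees (insert v V), ∑ e ∈ E,
            m e * ∏ f ∈ E.erase e, ω f t :=
          mul_le_mul_of_nonneg_left
            (sum_mul_treeSum_mul_treeSum_le (fun e => hω e t ht) hm0 hv) (Real.exp_pos _).le
      _ ≤ _ := by
          refine mul_le_mul_of_nonneg_left ?_ (Real.exp_pos _).le
          simp only [hy, hy', treeSum]
          rw [mul_sum, ← sum_add_distrib]
          refine sum_le_sum fun E hE => ?_
          have hEs := (mem_trees.1 hE).subset_edges
          have h1 : ∀ e ∈ E, (m e - κ e * ω e t) * ∏ f ∈ E.erase e, ω f t =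
              m e * ∏ f ∈ E.erase e, ω f t - κ e * ∏ f ∈ E, ω f t := by
            intro e he
            rw [← mul_prod_erase E _ he]
            ring
          rw [sum_congr rfl h1, sum_sub_distrib, ← sum_mul]
          have h2 : ∑ e ∈ E, κ e ≤ α := by
            rw [hα, hre]
            exact (sum_le_sum_of_subset_of_nonneg hEs fun _ _ _ => hκ _).trans (hst _)
          have h3 : 0 ≤ ∏ f ∈ E, ω f t := prod_nonneg fun _ _ => hω _ _ ht
          nlinarith [mul_le_mul_of_nonneg_right h2 h3]
  have hE : ∀ t : ℝ, HasDerivAt (fun t : ℝ => Complex.exp (t * U)) (U * Complex.exp (t * U)) t := by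
    intro t
    simpa using hasDerivAt_exp_neg_mul (-U) t
  have hf : ∀ t : ℝ, HasDerivAt
      (fun t : ℝ => Complex.exp (t * U) * connSum (scaledZeta u t) (insert v V))
      (-(Complex.exp (t * U) * X t)) t := by
    intro t
    refine ((hE t).mul (hasDerivAt_connSum_scaledZeta u hv t)).congr_deriv ?_
    rw [← hU]
    change U * _ * _ + _ * (-U * _ - X t) = _
    ring
  have hB : ∀ t : ℝ, HasDerivAt (fun t : ℝ => Real.exp (t * α) * y t)
      (Real.exp (t * α) * (α * y t + y' t)) t := by
    intro t
    have h1 : HasDerivAt (fun t : ℝ => t * α) α t := by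
      simpa using (hasDerivAt_id t).mul_const α
    refine (h1.exp.mul (hyd t)).congr_deriv ?_
    ring
  have hnorm : ∀ t : ℝ, ‖Complex.exp (t * U)‖ = Real.exp (t * U.re) := by
    intro t
    simp [Complex.norm_exp]
  have main := image_norm_le_of_norm_deriv_right_le_deriv_boundary (a := 0) (b := t)
    (fun x _ => (hf x).continuousAt.continuousWithinAt) (fun x _ => (hf x).hasDerivWithinAt)
    (B := fun t => Real.exp (t * α) * y t) ?_ hB ?_ (Set.right_mem_Icc.2 ht)
  · rw [norm_mul, hnorm] at main
    simp only [hα, mul_add, Real.exp_add, mul_assoc] at main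
    exact le_of_mul_le_mul_left main (Real.exp_pos _)
  · have : scaledZeta u 0 = fun _ => 0 := by ext; simp [scaledZeta]
    rw [this, connSum_zero (mem_insert_self v V) (mem_insert_of_mem hk) fun h => hv (h ▸ hk)]
    simpa using treeSum_nonneg (fun e => hω e 0 le_rfl) _
  · intro x hx
    rw [norm_neg, norm_mul, hnorm]
    refine (mul_le_mul_of_nonneg_left (hX_le x hx.1) (Real.exp_pos _).le).trans_eq ?_
    rw [← mul_assoc, ← Real.exp_add, ← mul_add]

end Interpolation

end ClusterExpansion

end

noncomputable section

namespace ClusterExpansion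

open Finset

section HardCore

open Filter Topology

variable {ι : Type*} [DecidableEq ι]

theorem norm_expNeg_coe (z : ℂ) : ‖expNeg (z : WithTop ℂ)‖ = Real.exp (-z.re) := by
  rw [expNeg_coe, Complex.norm_exp, Complex.neg_re]

/-- Tree-graph inequality for stable interactions, in terms of the potential. -/
theorem norm_connSum_le_treeSum_ubar [Fintype ι] {u : Sym2 ι → WithTop ℂ} {b : ι → ℝ}
    (hb : ∀ i, 0 ≤ b i)
    (hst : ∀ V : Finset ι, ∏ e ∈ edges V, ‖expNeg (u e)‖ ≤ ∏ i ∈ V, Real.exp (b i))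
    {V : Finset ι} (hV : V.Nonempty) :
    ‖connSum (fun e => expNeg (u e) - 1) V‖ ≤
      (∏ i ∈ V, Real.exp (b i)) * treeSum (fun e => ‖(u e).untopD 1‖) V := by
  classical
  set A : ℝ := ∑ e : Sym2 ι, ‖(u e).untopD 0‖ with hA
  have hA0 : 0 ≤ A := sum_nonneg fun _ _ => norm_nonneg _
  -- the hard core is replaced by a repulsion of strength `A + k`
  set v : ℝ → Sym2 ι → ℂ := fun k e => (u e).untopD ((A + k : ℝ) : ℂ) with hv
  set w : ℝ → Sym2 ι → ℝ := fun k e => if u e = ⊤ then (A + k) / k else ‖(u e).untopD 0‖ with hw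
  have bound : ∀ k : ℝ, 0 < k → ‖connSum (scaledZeta (v k) 1) V‖ ≤
      (∏ i ∈ V, Real.exp (b i)) * treeSum (w k) V := by
    intro k hk
    have := norm_connSum_scaledZeta_le (u := v k) (κ := fun e => if u e = ⊤ then k else 0)
      (m := fun e => ‖v k e‖)
      (ω := fun e t => if u e = ⊤ then (A + k) * ((1 - Real.exp (-(k * t))) / k)
        else ‖(u e).untopD 0‖ * t) (b := b) ?_ (fun e => le_rfl) ?_ ?_ hb ?_ hV zero_le_one
    · refine this.trans ?_
      rw [one_mul, Real.exp_sum]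
      refine mul_le_mul_of_nonneg_left (treeSum_mono ?_ ?_)
        (prod_nonneg fun _ _ => (Real.exp_pos _).le)
      · intro e
        split_ifs
        · have : Real.exp (-(k * 1)) ≤ 1 := Real.exp_le_one_iff.2 (by linarith)
          exact mul_nonneg (by linarith) (div_nonneg (by linarith) hk.le)
        · positivity
      · intro e _
        simp only [hw]
        split_ifs
        · rw [mul_div_assoc']
          gcongr
          have := Real.exp_pos (-(k * 1))
          nlinarith
        · simp
    · intro e
      split_ifs <;> [exact hk.le; exact le_rfl]
    · intro e t ht
      split_ifs
      · have : Real.exp (-(k * t)) ≤ 1 := Real.exp_le_one_iff.2 (by nlinarith)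
        exact mul_nonneg (by linarith) (div_nonneg (by linarith) hk.le)
      · positivity
    · intro e t
      by_cases he : u e = ⊤
      · simp only [he, if_true, hv, WithTop.untopD_top]
        have h1 : HasDerivAt (fun t : ℝ => -(k * t)) (-(k * 1)) t :=
          ((hasDerivAt_id t).const_mul k).neg
        refine (((h1.exp.const_sub 1).div_const k).const_mul (A + k)).congr_deriv ?_
        rw [Complex.norm_real, Real.norm_of_nonneg (by linarith)]
        field_simp
        ring
      · obtain ⟨z, hz⟩ := WithTop.ne_top_iff_exists.1 he
        simp only [← hz, WithTop.coe_ne_top, if_false, hv, WithTop.untopD_coe, zero_mul, sub_zero]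
        simpa using (hasDerivAt_id t).const_mul ‖z‖
    · intro W
      set r : Sym2 ι → ℝ := fun e => (v k e).re - if u e = ⊤ then k else 0 with hr
      suffices 0 ≤ ∑ e ∈ edges W, r e + ∑ i ∈ W, b i by
        simp only [hr, sum_sub_distrib] at this
        linarith
      have hr1 : ∀ e, -‖(u e).untopD 0‖ ≤ r e := by
        intro e
        by_cases he : u e = ⊤
        · simp [hr, hv, he, hA0]
        · obtain ⟨z, hz⟩ := WithTop.ne_top_iff_exists.1 he
          simp only [hr, hv, ← hz, WithTop.coe_ne_top, if_false, WithTop.untopD_coe, sub_zero]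
          exact (abs_le.1 (Complex.abs_re_le_norm z)).1
      by_cases hex : ∃ e ∈ edges W, u e = ⊤
      · obtain ⟨e, heW, he⟩ := hex
        have h1 : ∑ f ∈ (edges W).erase e, -‖(u f).untopD 0‖ ≤ ∑ f ∈ (edges W).erase e, r f :=
          sum_le_sum fun f _ => hr1 f
        have h2 : ∑ f ∈ (edges W).erase e, ‖(u f).untopD 0‖ ≤ A :=
          sum_le_sum_of_subset_of_nonneg (subset_univ _) fun _ _ _ => norm_nonneg _
        have h3 : r e = A := by simp [hr, hv, he]
        have h4 : 0 ≤ ∑ i ∈ W, b i := sum_nonneg fun i _ => hb i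
        rw [← add_sum_erase _ _ heW, h3]
        rw [sum_neg_distrib] at h1
        linarith
      · push Not at hex
        have h1 : ∏ e ∈ edges W, ‖expNeg (u e)‖ = Real.exp (-∑ e ∈ edges W, r e) := by
          rw [← sum_neg_distrib, Real.exp_sum]
          refine prod_congr rfl fun e he => ?_
          obtain ⟨z, hz⟩ := WithTop.ne_top_iff_exists.1 (hex e he)
          simp [hr, hv, ← hz, norm_expNeg_coe]
        have h2 := hst W
        rw [h1, ← Real.exp_sum, Real.exp_le_exp] at h2
        linarith
  have lim1 : Tendsto (fun k => connSum (scaledZeta (v k) 1) V) atTop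
      (𝓝 (connSum (fun e => expNeg (u e) - 1) V)) := by
    refine tendsto_finsetSum _ fun E _ => tendsto_finsetProd _ fun e _ => ?_
    by_cases he : u e = ⊤
    · simp only [scaledZeta, hv, he, WithTop.untopD_top, expNeg_top, Complex.ofReal_one, one_mul]
      refine Tendsto.sub_const ?_ 1
      simp only [← Complex.ofReal_neg, ← Complex.ofReal_exp]
      rw [← Complex.ofReal_zero]
      refine (Complex.continuous_ofReal.tendsto 0).comp ?_
      exact Real.tendsto_exp_neg_atTop_nhds_zero.comp (tendsto_atTop_add_const_left _ A tendsto_id)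
    · obtain ⟨z, hz⟩ := WithTop.ne_top_iff_exists.1 he
      simp only [scaledZeta, hv, ← hz, WithTop.untopD_coe, expNeg_coe, Complex.ofReal_one, one_mul]
      exact tendsto_const_nhds
  have lim2 : Tendsto (fun k => (∏ i ∈ V, Real.exp (b i)) * treeSum (w k) V) atTop
      (𝓝 ((∏ i ∈ V, Real.exp (b i)) * treeSum (fun e => ‖(u e).untopD 1‖) V)) := by
    refine Tendsto.const_mul _
      (tendsto_finsetSum _ fun E _ => tendsto_finsetProd _ fun e _ => ?_)
    by_cases he : u e = ⊤
    · simp only [hw, he, if_true, WithTop.untopD_top, norm_one]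
      have : Tendsto (fun k : ℝ => A * k⁻¹ + 1) atTop (𝓝 (A * 0 + 1)) :=
        (tendsto_inv_atTop_zero.const_mul A).add_const 1
      rw [mul_zero, zero_add] at this
      refine this.congr' ?_
      filter_upwards [eventually_gt_atTop 0] with k hk
      field_simp
    · obtain ⟨z, hz⟩ := WithTop.ne_top_iff_exists.1 he
      simp only [hw, ← hz, WithTop.coe_ne_top, if_false, WithTop.untopD_coe]
      exact tendsto_const_nhds
  refine le_of_tendsto_of_tendsto lim1.norm lim2 ?_
  filter_upwards [eventually_gt_atTop 0] with k hk using bound k hk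

end HardCore

section Relabeling

variable {ι κ : Type*} [DecidableEq ι] [DecidableEq κ]

theorem edges_map (f : κ ↪ ι) (V : Finset κ) : edges (V.map f) = (edges V).map f.sym2Map := by
  ext e
  induction e with | _ i j
  simp only [mk_mem_edges, mem_map, Function.Embedding.sym2Map_apply]
  constructor
  · rintro ⟨⟨a, ha, rfl⟩, ⟨b, hb, rfl⟩, h⟩
    exact ⟨s(a, b), mk_mem_edges.2 ⟨ha, hb, fun h' => h (h' ▸ rfl)⟩, rfl⟩
  · rintro ⟨e, he, h⟩
    induction e with | _ a b
    rw [mk_mem_edges] at he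
    rw [Sym2.map_mk, Sym2.eq_iff] at h
    rcases h with ⟨rfl, rfl⟩ | ⟨rfl, rfl⟩
    · exact ⟨⟨a, he.1, rfl⟩, ⟨b, he.2.1, rfl⟩, fun h => he.2.2 (f.injective h)⟩
    · exact ⟨⟨b, he.2.1, rfl⟩, ⟨a, he.1, rfl⟩, fun h => he.2.2 (f.injective h).symm⟩

theorem fullProd_map {R : Type*} [CommRing R] (ζ : Sym2 ι → R) (f : κ ↪ ι) (V : Finset κ) :
    fullProd ζ (V.map f) = fullProd (fun e => ζ (e.map f)) V := by
  simp [fullProd, edges_map]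

theorem connSum_map {R : Type*} [CommRing R] (ζ : Sym2 ι → R) (f : κ ↪ ι) {V : Finset κ}
    (hV : V.Nonempty) : connSum ζ (V.map f) = connSum (fun e => ζ (e.map f)) V := by
  obtain ⟨v, hv⟩ := hV
  obtain ⟨V, hvV, rfl⟩ : ∃ V', v ∉ V' ∧ insert v V' = V :=
    ⟨V.erase v, notMem_erase _ _, insert_erase hv⟩
  refine eq_of_sum_powerset_mul_eq (F := fullProd fun e => ζ (e.map f))
    (f := fun S => connSum ζ ((insert v S).map f))
    (g := fun S => connSum (fun e => ζ (e.map f)) (insert v S)) (fullProd_empty _) V fun Q hQ => ?_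
  have hvQ : v ∉ Q := fun h => hvV (hQ h)
  rw [← fullProd_insert _ hvQ, ← fullProd_map, map_insert,
    fullProd_insert _ (by simpa using hvQ)]
  refine sum_bij (fun S _ => S.map f) ?_ ?_ ?_ ?_
  · intro S hS
    simpa using hS
  · intro S _ T _ h
    simpa using h
  · intro T hT
    obtain ⟨S, hS, rfl⟩ := subset_map_iff.1 (mem_powerset.1 hT)
    exact ⟨S, mem_powerset.2 hS, rfl⟩
  · intro S hS
    rw [map_insert, ← fullProd_map, ← Finset.map_sdiff]

theorem TreeOn.map (f : κ ↪ ι) {V : Finset κ} {E : Finset (Sym2 κ)} (h : TreeOn V E) :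
    TreeOn (V.map f) (E.map f.sym2Map) := by
  induction h with
  | single v => simpa using TreeOn.single (f v)
  | @join V₁ V₂ E₁ E₂ i j hd _ _ hi hj ih₁ ih₂ =>
    have := TreeOn.join ((disjoint_map f).2 hd) ih₁ ih₂ (mem_map_of_mem f hi) (mem_map_of_mem f hj)
    rwa [← map_union, ← map_union, show s(f i, f j) = f.sym2Map s(i, j) from rfl,
      ← map_insert] at this

theorem TreeOn.exists_eq_map (f : κ ↪ ι) {W : Finset ι} {E : Finset (Sym2 ι)} (h : TreeOn W E) :
    ∀ V : Finset κ, W = V.map f → ∃ E', TreeOn V E' ∧ E = E'.map f.sym2Map := by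
  induction h with
  | single v =>
    intro V hV
    obtain ⟨a, -, rfl⟩ := mem_map.1 (hV ▸ mem_singleton_self v)
    rw [← map_singleton, map_inj] at hV
    subst hV
    exact ⟨∅, .single a, rfl⟩
  | @join V₁ V₂ E₁ E₂ i j hd _ _ hi hj ih₁ ih₂ =>
    intro V hV
    obtain ⟨W₁, -, rfl⟩ := subset_map_iff.1 (hV ▸ subset_union_left : V₁ ⊆ V.map f)
    obtain ⟨W₂, -, rfl⟩ := subset_map_iff.1 (hV ▸ subset_union_right : V₂ ⊆ V.map f)
    obtain ⟨F₁, h₁, rfl⟩ := ih₁ W₁ rfl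
    obtain ⟨F₂, h₂, rfl⟩ := ih₂ W₂ rfl
    obtain ⟨a, ha, rfl⟩ := mem_map.1 hi
    obtain ⟨b, hb, rfl⟩ := mem_map.1 hj
    rw [← map_union, map_inj] at hV
    subst hV
    refine ⟨_, .join ((disjoint_map f).1 hd) h₁ h₂ ha hb, ?_⟩
    rw [map_insert, map_union]
    rfl

theorem treeSum_map {R : Type*} [CommSemiring R] (w : Sym2 ι → R) (f : κ ↪ ι) (V : Finset κ) :
    treeSum w (V.map f) = treeSum (fun e => w (e.map f)) V := by
  symm
  refine sum_bij (fun E _ => E.map f.sym2Map) ?_ ?_ ?_ ?_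
  · intro E hE
    exact mem_trees.2 ((mem_trees.1 hE).map f)
  · intro E _ E' _ h
    simpa using h
  · intro E hE
    obtain ⟨E', h1, h2⟩ := (mem_trees.1 hE).exists_eq_map f V rfl
    exact ⟨E', mem_trees.2 h1, h2.symm⟩
  · intro E _
    simp

end Relabeling

end ClusterExpansion

end

noncomputable section

namespace ClusterExpansion

open Finset

section ExponentialSeries

theorem sum_range_le_exp_sum_range {A B : ℕ → ℝ} (hA : ∀ n, 0 ≤ A n) (hB : ∀ n, 0 ≤ B n)
    (hA0 : A 0 ≤ 1) (N : ℕ)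
    (h : ∀ n < N, (n + 1) * A (n + 1) ≤ ∑ k ∈ range (n + 1), (k + 1) * B k * A (n - k)) :
    ∑ n ∈ range (N + 1), A n ≤ Real.exp (∑ k ∈ range N, B k) := by
  set P : ℝ → ℝ := fun t => ∑ n ∈ range (N + 1), A n * t ^ n with hP
  set Q : ℝ → ℝ := fun t => ∑ k ∈ range N, B k * t ^ (k + 1) with hQ
  set P' : ℝ → ℝ := fun t => ∑ n ∈ range N, (n + 1) * A (n + 1) * t ^ n with hP'
  set Q' : ℝ → ℝ := fun t => ∑ k ∈ range N, (k + 1) * B k * t ^ k with hQ'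
  have dP : ∀ t, HasDerivAt P (P' t) t := by
    intro t
    have h1 : P = fun t => (∑ n ∈ range N, A (n + 1) * t ^ (n + 1)) + A 0 := by
      ext t
      simp [hP, sum_range_succ']
    rw [h1]
    refine (HasDerivAt.fun_sum fun n _ => (hasDerivAt_pow (n + 1) t).const_mul _).add_const _
      |>.congr_deriv ?_
    refine sum_congr rfl fun n _ => ?_
    push_cast [Nat.add_sub_cancel]
    ring
  have dQ : ∀ t, HasDerivAt Q (Q' t) t := by
    intro t
    refine (HasDerivAt.fun_sum fun n _ => (hasDerivAt_pow (n + 1) t).const_mul _).congr_deriv ?_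
    refine sum_congr rfl fun n _ => ?_
    push_cast [Nat.add_sub_cancel]
    ring
  have key : ∀ t, 0 ≤ t → P' t ≤ Q' t * P t := by
    intro t ht
    calc P' t ≤ ∑ n ∈ range N, ∑ k ∈ range (n + 1), ((k + 1) * B k * t ^ k) *
          (A (n - k) * t ^ (n - k)) := by
          refine sum_le_sum fun n hn => ?_
          refine (mul_le_mul_of_nonneg_right (h n (mem_range.1 hn)) (pow_nonneg ht n)).trans_eq ?_
          rw [sum_mul]
          refine sum_congr rfl fun k hk => ?_
          rw [← Nat.add_sub_of_le (Nat.lt_succ_iff.1 (mem_range.1 hk)), pow_add,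
            Nat.add_sub_cancel_left]
          ring
      _ ≤ Q' t * P t := by
          simp only [hQ', hP, sum_mul_sum]
          rw [← sum_product', sum_sigma']
          refine sum_le_sum_of_injOn (fun p : (_ : ℕ) × ℕ => (p.2, p.1 - p.2)) ?_ ?_
            (fun _ _ => le_rfl) ?_
          · rintro ⟨n, k⟩ hp
            simp only [mem_sigma, mem_range, mem_product] at hp ⊢
            omega
          · rintro ⟨n, k⟩ hp ⟨n', k'⟩ hp' heq
            simp only [coe_sigma, Set.mem_sigma_iff, mem_coe, mem_range, Prod.mk.injEq] at hp hp' heq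
            obtain rfl : k = k' := heq.1
            obtain rfl : n = n' := by omega
            rfl
          · rintro ⟨k, j⟩ _
            have := hA j
            have := hB k
            positivity
  have anti : AntitoneOn (fun t => P t * Real.exp (-Q t)) (Set.Icc 0 1) := by
    have hd : ∀ t, HasDerivAt (fun t => P t * Real.exp (-Q t))
        ((P' t - Q' t * P t) * Real.exp (-Q t)) t := by
      intro t
      refine ((dP t).mul (dQ t).neg.exp).congr_deriv ?_
      rw [Pi.neg_apply]
      ring
    refine antitoneOn_of_deriv_nonpos (convex_Icc 0 1)
      (fun t _ => (hd t).continuousAt.continuousWithinAt)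
      (fun t _ => (hd t).differentiableAt.differentiableWithinAt) fun t ht => ?_
    rw [interior_Icc] at ht
    rw [(hd t).deriv]
    exact mul_nonpos_of_nonpos_of_nonneg (sub_nonpos.2 (key t ht.1.le)) (Real.exp_pos _).le
  have h1 := anti (Set.left_mem_Icc.2 zero_le_one) (Set.right_mem_Icc.2 zero_le_one) zero_le_one
  have hP0 : P 0 = A 0 := by simp [hP, sum_range_succ']
  have hQ0 : Q 0 = 0 := by simp [hQ]
  have hP1 : P 1 = ∑ n ∈ range (N + 1), A n := by simp [hP]
  have hQ1 : Q 1 = ∑ k ∈ range N, B k := by simp [hQ]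
  simp only [hP0, hQ0, hP1, hQ1, neg_zero, Real.exp_zero, mul_one, Real.exp_neg] at h1
  rw [← div_eq_mul_inv, div_le_iff₀ (Real.exp_pos _)] at h1
  exact h1.trans (mul_le_of_le_one_left (Real.exp_pos _).le hA0)

theorem sum_range_le_ofReal_exp {A B : ℕ → ℝ≥0∞} {β : ℝ} (hA0 : A 0 ≤ 1) (N : ℕ)
    (hB : ∑ k ∈ range N, B k ≤ ENNReal.ofReal β) (hβ : 0 ≤ β)
    (h : ∀ n < N, ((n + 1 : ℕ) : ℝ≥0∞) * A (n + 1) ≤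
      ∑ k ∈ range (n + 1), ((k + 1 : ℕ) : ℝ≥0∞) * B k * A (n - k)) :
    ∑ n ∈ range (N + 1), A n ≤ ENNReal.ofReal (Real.exp β) := by
  have fB : ∀ k < N, B k ≠ ∞ := fun k hk => ne_top_of_le_ne_top ENNReal.ofReal_ne_top
    ((single_le_sum (fun _ _ => zero_le) (mem_range.2 hk)).trans hB)
  have fA : ∀ n ≤ N, A n ≠ ∞ := by
    intro n
    induction n using Nat.strong_induction_on with
    | _ n ih =>
      intro hn
      cases n with
      | zero => exact ne_top_of_le_ne_top ENNReal.one_ne_top hA0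
      | succ n =>
        have h1 : ((n + 1 : ℕ) : ℝ≥0∞) * A (n + 1) ≠ ∞ := by
          refine ne_top_of_le_ne_top ?_ (h n hn)
          refine ENNReal.sum_ne_top.2 fun k hk => ?_
          have hk := mem_range.1 hk
          exact ENNReal.mul_ne_top (ENNReal.mul_ne_top (by simp) (fB k (by omega)))
            (ih (n - k) (by omega) (by omega))
        intro h2
        rw [h2, ENNReal.mul_top (by simp)] at h1
        exact h1 rfl
  have main := sum_range_le_exp_sum_range (A := fun n => (A n).toReal) (B := fun n => (B n).toReal)
    (fun _ => ENNReal.toReal_nonneg) (fun _ => ENNReal.toReal_nonneg)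
    (by simpa using ENNReal.toReal_mono ENNReal.one_ne_top hA0) N ?_
  · rw [← ENNReal.toReal_sum fun n hn => fA n (Nat.lt_succ_iff.1 (mem_range.1 hn)),
      ← ENNReal.toReal_sum fun n hn => fB n (mem_range.1 hn)] at main
    have h3 : (∑ k ∈ range N, B k).toReal ≤ β := ENNReal.toReal_le_of_le_ofReal hβ hB
    exact (ENNReal.le_ofReal_iff_toReal_le
      (ENNReal.sum_ne_top.2 fun n hn => fA n (Nat.lt_succ_iff.1 (mem_range.1 hn)))
      (Real.exp_pos _).le).2 (main.trans (Real.exp_le_exp.2 h3))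
  · intro n hn
    have h1 := ENNReal.toReal_mono ?_ (h n hn)
    · rw [ENNReal.toReal_sum] at h1
      · simp only [ENNReal.toReal_mul, ENNReal.toReal_natCast] at h1
        exact_mod_cast h1
      · intro k hk
        have hk := mem_range.1 hk
        exact ENNReal.mul_ne_top (ENNReal.mul_ne_top (by simp) (fB k (by omega)))
          (fA _ (by omega))
    · refine ENNReal.sum_ne_top.2 fun k hk => ?_
      have hk := mem_range.1 hk
      exact ENNReal.mul_ne_top (ENNReal.mul_ne_top (by simp) (fB k (by omega)))
        (fA _ (by omega))

theorem hasDerivAt_tsum_mul_pow_succ {d : ℕ → ℂ} (hd : Summable fun k : ℕ => (k + 1 : ℝ) * ‖d k‖)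
    {t : ℝ} (ht : t ∈ Metric.ball (0 : ℝ) 1) :
    HasDerivAt (fun t : ℝ => ∑' k, d k * (t : ℂ) ^ (k + 1))
      (∑' k : ℕ, (k + 1 : ℂ) * d k * (t : ℂ) ^ k) t := by
  refine hasDerivAt_tsum_of_isPreconnected hd Metric.isOpen_ball
    (convex_ball (0 : ℝ) 1).isPreconnected (g := fun k (t : ℝ) => d k * (t : ℂ) ^ (k + 1))
    (g' := fun k (t : ℝ) => (k + 1 : ℂ) * d k * (t : ℂ) ^ k) (fun k s _ => ?_) (fun k s hs => ?_)
    (Metric.mem_ball_self one_pos) ?_ ht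
  · have h1 : HasDerivAt (fun s : ℝ => (s : ℂ) ^ (k + 1)) (((k + 1 : ℕ) : ℂ) * (s : ℂ) ^ k * 1) s :=
      ((Complex.ofRealCLM.hasDerivAt (x := s)).pow (k + 1)).congr_deriv (by simp)
    refine (h1.const_mul (d k)).congr_deriv ?_
    push_cast
    ring
  · rw [norm_mul, norm_mul, norm_pow, Complex.norm_real]
    rw [mem_ball_zero_iff] at hs
    have h2 : ‖(k + 1 : ℂ)‖ = k + 1 := by
      rw [← Nat.cast_succ, Complex.norm_natCast, Nat.cast_succ]
    rw [h2]
    exact mul_le_of_le_one_right (by positivity) (pow_le_one₀ (norm_nonneg _) hs.le)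
  · simp

theorem continuousOn_tsum_mul_pow_succ {d : ℕ → ℂ} (hd : Summable fun k => ‖d k‖) :
    ContinuousOn (fun t : ℝ => ∑' k, d k * (t : ℂ) ^ (k + 1)) (Set.Icc 0 1) := by
  refine continuousOn_tsum (fun k => by fun_prop) hd fun k t ht => ?_
  rw [norm_mul, norm_pow, Complex.norm_real, Real.norm_of_nonneg ht.1]
  exact mul_le_of_le_one_right (norm_nonneg _) (pow_le_one₀ ht.1 ht.2)

/-- The exponential formula: `P' = C' P` and `P(0) = 1` imply `P = exp C`. -/
theorem tsum_eq_exp_tsum {p c : ℕ → ℂ} (hp : Summable fun n : ℕ => (n + 1 : ℝ) * ‖p (n + 1)‖)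
    (hc : Summable fun n : ℕ => (n + 1 : ℝ) * ‖c n‖) (hp0 : p 0 = 1)
    (h : ∀ n : ℕ, (n + 1 : ℂ) * p (n + 1) =
      ∑ k ∈ range (n + 1), (k + 1 : ℂ) * c k * p (n - k)) :
    ∑' n, p n = Complex.exp (∑' n, c n) := by
  have weaken : ∀ {d : ℕ → ℂ}, (Summable fun n : ℕ => (n + 1 : ℝ) * ‖d n‖) →
      Summable fun n => ‖d n‖ := fun hd =>
    hd.of_nonneg_of_le (fun _ => norm_nonneg _)
      fun n => le_mul_of_one_le_left (norm_nonneg _) (by simp)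
  have hp1 : Summable fun n => ‖p n‖ := (summable_nat_add_iff 1).1 (weaken hp)
  set f : ℝ → ℂ := fun t => 1 + ∑' k, p (k + 1) * (t : ℂ) ^ (k + 1) with hf
  set g : ℝ → ℂ := fun t => ∑' k, c k * (t : ℂ) ^ (k + 1) with hg
  have key : ∀ t ∈ Set.Ico (0 : ℝ) 1, ∑' k : ℕ, (k + 1 : ℂ) * p (k + 1) * (t : ℂ) ^ k =
      (∑' k : ℕ, (k + 1 : ℂ) * c k * (t : ℂ) ^ k) * f t := by
    intro t ht
    have hpow : ∀ n, ‖(t : ℂ) ^ n‖ ≤ 1 := fun n => by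
      rw [norm_pow, Complex.norm_real, Real.norm_of_nonneg ht.1]
      exact pow_le_one₀ ht.1 ht.2.le
    have s1 : Summable fun n => ‖p n * (t : ℂ) ^ n‖ :=
      hp1.of_nonneg_of_le (fun _ => norm_nonneg _) fun n => by
        rw [norm_mul]
        exact mul_le_of_le_one_right (norm_nonneg _) (hpow n)
    have s2 : Summable fun k : ℕ => ‖(k + 1 : ℂ) * c k * (t : ℂ) ^ k‖ :=
      hc.of_nonneg_of_le (fun _ => norm_nonneg _) fun k => by
        have h2 : ‖(k + 1 : ℂ)‖ = k + 1 := by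
          rw [← Nat.cast_succ, Complex.norm_natCast, Nat.cast_succ]
        rw [norm_mul, norm_mul, h2]
        exact mul_le_of_le_one_right (by positivity) (hpow k)
    have hft : f t = ∑' n, p n * (t : ℂ) ^ n := by
      rw [s1.of_norm.tsum_eq_zero_add, hp0, hf]
      simp
    rw [hft, tsum_mul_tsum_eq_tsum_sum_range_of_summable_norm s2 s1]
    refine tsum_congr fun n => ?_
    rw [h n, sum_mul]
    refine sum_congr rfl fun k hk => ?_
    rw [← Nat.add_sub_of_le (Nat.lt_succ_iff.1 (mem_range.1 hk)), pow_add,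
      Nat.add_sub_cancel_left]
    ring
  have const := constant_of_has_deriv_right_zero (f := fun t => f t * Complex.exp (-g t))
    (a := 0) (b := 1) ?_ ?_ 1 (Set.right_mem_Icc.2 zero_le_one)
  · have e1 : f 1 = ∑' n, p n := by
      rw [hp1.of_norm.tsum_eq_zero_add, hp0, hf]
      simp
    have e2 : g 1 = ∑' n, c n := by simp [hg]
    have e3 : f 0 = 1 := by simp [hf]
    have e4 : g 0 = 0 := by simp [hg]
    simp only [e1, e2, e3, e4, neg_zero, Complex.exp_zero, mul_one] at const
    rw [Complex.exp_neg, ← div_eq_mul_inv, div_eq_one_iff_eq (Complex.exp_ne_zero _)] at const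
    exact const
  · exact (continuousOn_const.add (continuousOn_tsum_mul_pow_succ (weaken hp))).mul
      (continuousOn_tsum_mul_pow_succ (weaken hc)).neg.cexp
  · intro t ht
    have htb : t ∈ Metric.ball (0 : ℝ) 1 := by
      rw [mem_ball_zero_iff, Real.norm_of_nonneg ht.1]
      exact ht.2
    have d1 : HasDerivAt f _ t := (hasDerivAt_tsum_mul_pow_succ hp htb).const_add 1
    have d2 : HasDerivAt g _ t := hasDerivAt_tsum_mul_pow_succ hc htb
    refine ((d1.mul d2.neg.cexp).congr_deriv ?_).hasDerivWithinAt
    rw [key t ht]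
    ring

end ExponentialSeries

section Graphs

variable {X : Type*}

@[simp]
theorem expNeg_zero : expNeg 0 = 1 := by
  rw [← WithTop.coe_zero, expNeg_coe, neg_zero, Complex.exp_zero]

theorem expNeg_add (a b : WithTop ℂ) : expNeg (a + b) = expNeg a * expNeg b := by
  induction a with
  | top => simp [expNeg_top]
  | coe a =>
    induction b with
    | top => simp [expNeg_top]
    | coe b => rw [← WithTop.coe_add, expNeg_coe, expNeg_coe, expNeg_coe, neg_add, Complex.exp_add]

theorem expNeg_sum {α : Type*} (s : Finset α) (f : α → WithTop ℂ) :
    expNeg (∑ i ∈ s, f i) = ∏ i ∈ s, expNeg (f i) := by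
  classical
  induction s using Finset.induction_on with
  | empty => simp
  | insert a s ha ih => rw [sum_insert ha, prod_insert ha, expNeg_add, ih]

theorem mem_pairs {n : ℕ} {p : Fin n × Fin n} : p ∈ pairs n ↔ p.1 < p.2 := by
  simp [pairs]

theorem prod_pairs_filter {R : Type*} [CommMonoid R] {n : ℕ} (f : Sym2 (Fin n) → R)
    (E : Finset (Sym2 (Fin n))) (hE : E ⊆ edges univ) :
    ∏ p ∈ (pairs n).filter fun p => s(p.1, p.2) ∈ E, f s(p.1, p.2) = ∏ e ∈ E, f e := by
  refine prod_bij (fun p _ => s(p.1, p.2)) ?_ ?_ ?_ fun _ _ => rfl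
  · intro p hp
    exact (mem_filter.1 hp).2
  · rintro ⟨i, j⟩ hp ⟨i', j'⟩ hp' h
    have h1 := mem_pairs.1 (mem_filter.1 hp).1
    have h2 := mem_pairs.1 (mem_filter.1 hp').1
    rcases Sym2.eq_iff.1 h with ⟨rfl, rfl⟩ | ⟨rfl, rfl⟩
    · rfl
    · exact absurd h1 (not_lt.2 (le_of_lt h2))
  · intro e he
    induction e with | _ i j
    have hij := (mk_mem_edges.1 (hE he)).2.2
    rcases lt_or_gt_of_ne hij with h | h
    · exact ⟨(i, j), mem_filter.2 ⟨mem_pairs.2 h, he⟩, rfl⟩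
    · exact ⟨(j, i), mem_filter.2 ⟨mem_pairs.2 h, by rwa [Sym2.eq_swap]⟩, Sym2.eq_swap⟩

theorem prod_pairs {R : Type*} [CommMonoid R] {n : ℕ} (f : Sym2 (Fin n) → R) :
    ∏ p ∈ pairs n, f s(p.1, p.2) = ∏ e ∈ edges univ, f e := by
  rw [← prod_pairs_filter f _ subset_rfl, filter_true_of_mem]
  intro p hp
  simpa using (mem_pairs.1 hp).ne

/-- The potential as a function on unordered pairs. -/
def symmPotential (u : X → X → WithTop ℂ) (hu : ∀ x y, u x y = u y x) : Sym2 X → WithTop ℂ :=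
  Sym2.lift ⟨u, hu⟩

variable {u : X → X → WithTop ℂ} (hu : ∀ x y, u x y = u y x)

/-- The function `ζ` on unordered pairs of labels of the points `x`. -/
def edgeZeta {ι : Type*} (x : ι → X) (e : Sym2 ι) : ℂ := expNeg (symmPotential u hu (e.map x)) - 1

/-- The function `ū` on unordered pairs of labels of the points `x`. -/
def edgeUbar {ι : Type*} (x : ι → X) (e : Sym2 ι) : ℂ := (symmPotential u hu (e.map x)).untopD 1

@[simp]
theorem edgeZeta_mk {ι : Type*} (x : ι → X) (i j : ι) :
    edgeZeta hu x s(i, j) = zeta u (x i) (x j) := rfl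

theorem boltzmann_eq_fullProd {n : ℕ} (x : Fin n → X) :
    boltzmann u x = fullProd (edgeZeta hu x) univ := by
  rw [boltzmann, expNeg_sum, fullProd, ← prod_pairs]
  simp [zeta]

theorem connected_iff_connOn {n : ℕ} (G : SimpleGraph (Fin (n + 1))) {E : Finset (Sym2 (Fin (n + 1)))}
    (hE : ∀ i j, s(i, j) ∈ E ↔ G.Adj i j) : G.Connected ↔ ConnOn univ E := by
  constructor
  · intro h P hP i _ j _ hi
    obtain ⟨w⟩ := h.preconnected i j
    induction w with
    | nil => exact hi
    | cons hadj _ ih => exact ih (mem_univ _) (mem_univ _) (hP _ _ ((hE _ _).2 hadj) hi)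
  · intro h
    refine ⟨fun i j => ?_⟩
    refine h {k | G.Reachable i k} ?_ i (mem_univ _) j (mem_univ _) (SimpleGraph.Reachable.refl i)
    intro a b hab ha
    exact SimpleGraph.Reachable.trans ha ((hE a b).1 hab).reachable

theorem phi_eq_connSum {n : ℕ} (x : Fin (n + 1) → X) :
    phi u x = (((n + 1)! : ℕ) : ℂ)⁻¹ * connSum (edgeZeta hu x) univ := by
  classical
  rw [phi, connSum]
  congr 1
  have hmem : ∀ (G : SimpleGraph (Fin (n + 1))) (i j : Fin (n + 1)),
      s(i, j) ∈ (edges univ).filter (fun e => e ∈ G.edgeSet) ↔ G.Adj i j := by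
    intro G i j
    simp only [mem_filter, mk_mem_edges, mem_univ, true_and, SimpleGraph.mem_edgeSet,
      and_iff_right_iff_imp]
    exact fun h => h.ne
  refine sum_bij (fun G _ => (edges univ).filter fun e => e ∈ G.edgeSet) ?_ ?_ ?_ ?_
  · intro G hG
    rw [mem_filter, mem_powerset]
    exact ⟨filter_subset _ _, (connected_iff_connOn G (hmem G)).1 (mem_filter.1 hG).2⟩
  · intro G _ G' _ h
    ext i j
    rw [← hmem G, ← hmem G', h]
  · intro E hE
    obtain ⟨h1, h2⟩ := mem_filter.1 hE
    have h3 : ∀ i j, s(i, j) ∈ E ↔ (SimpleGraph.fromEdgeSet (E : Set (Sym2 (Fin (n + 1))))).Adj i j := by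
      intro i j
      rw [SimpleGraph.fromEdgeSet_adj, mem_coe]
      exact ⟨fun h => ⟨h, (mk_mem_edges.1 (mem_powerset.1 h1 h)).2.2⟩, fun h => h.1⟩
    refine ⟨SimpleGraph.fromEdgeSet E, mem_filter.2 ⟨mem_univ _, (connected_iff_connOn _ h3).2 h2⟩, ?_⟩
    ext e
    induction e with | _ i j
    rw [hmem, h3]
  · intro G _
    rw [← prod_pairs_filter _ _ (filter_subset _ _)]
    refine prod_congr ?_ fun _ _ => rfl
    ext p
    simp only [mem_filter, hmem]

end Graphs

end ClusterExpansion

end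

noncomputable section

namespace ClusterExpansion

open Finset

section ProductMeasure

variable {X : Type*} [MeasurableSpace X] (ν : Measure X) [SigmaFinite ν]

theorem measurePreserving_comp_equiv {ι κ : Type*} [Fintype ι] [Fintype κ] (e : κ ≃ ι) :
    MeasurePreserving (fun x : ι → X => x ∘ e) (Measure.pi fun _ => ν)
      (Measure.pi fun _ => ν) := by
  convert measurePreserving_piCongrLeft (fun _ : κ => ν) e.symm using 1
  ext x k
  have := Equiv.piCongrLeft_apply_apply (fun _ : κ => X) e.symm x (e k)
  rw [Equiv.symm_apply_apply] at this
  rw [MeasurableEquiv.coe_piCongrLeft, this]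
  rfl

theorem measurePreserving_split {ι κ σ : Type*} [Fintype ι] [Fintype κ] [Fintype σ]
    (e : κ ⊕ σ ≃ ι) :
    MeasurePreserving (fun x : ι → X => (fun i => x (e (Sum.inl i)), fun i => x (e (Sum.inr i))))
      (Measure.pi fun _ => ν) ((Measure.pi fun _ => ν).prod (Measure.pi fun _ => ν)) :=
  (measurePreserving_sumPiEquivProdPi (fun _ : κ ⊕ σ => ν)).comp
    (measurePreserving_comp_equiv ν e)

theorem map_finSumEquivOfFinset_inl {N k m : ℕ} {T : Finset (Fin N)} (hk : T.card = k)
    (hm : Tᶜ.card = m) :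
    (univ : Finset (Fin k)).map (Function.Embedding.inl.trans
      (finSumEquivOfFinset hk hm).toEmbedding) = T := by
  conv_rhs => rw [← map_orderEmbOfFin_univ T hk]
  congr 1

theorem map_finSumEquivOfFinset_inr {N k m : ℕ} {T : Finset (Fin N)} (hk : T.card = k)
    (hm : Tᶜ.card = m) :
    (univ : Finset (Fin m)).map (Function.Embedding.inr.trans
      (finSumEquivOfFinset hk hm).toEmbedding) = Tᶜ := by
  conv_rhs => rw [← map_orderEmbOfFin_univ Tᶜ hm]
  congr 1

/-- A sum over the subsets of `Fin (n + 1)` that contain `0`, of a function of the cardinality. -/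
theorem sum_powerset_erase_zero {R : Type*} [CommSemiring R] {n : ℕ} (f : Finset (Fin (n + 1)) → R)
    (g : ℕ → R) (h : ∀ S ⊆ univ.erase 0, f S = g S.card) :
    ∑ S ∈ (univ.erase (0 : Fin (n + 1))).powerset, f S =
      ∑ k ∈ range (n + 1), (n.choose k : R) * g k := by
  have := sum_powerset_apply_card g (x := univ.erase (0 : Fin (n + 1)))
  rw [card_erase_of_mem (mem_univ _), card_univ, Fintype.card_fin, Nat.add_sub_cancel] at this
  rw [sum_congr rfl fun S hS => h S (mem_powerset.1 hS), this]
  simp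

theorem card_insert_zero {n : ℕ} {S : Finset (Fin (n + 1))} (hS : S ⊆ univ.erase 0) :
    (insert 0 S).card = S.card + 1 :=
  card_insert_of_notMem fun h => notMem_erase _ _ (hS h)

theorem card_compl_insert_zero {n : ℕ} {S : Finset (Fin (n + 1))} (hS : S ⊆ univ.erase 0) :
    (insert 0 S)ᶜ.card = n - S.card := by
  rw [card_compl, card_insert_zero hS, Fintype.card_fin]
  omega

theorem compl_insert_zero {n : ℕ} (S : Finset (Fin (n + 1))) :
    (insert 0 S)ᶜ = univ.erase 0 \ S := by
  ext i
  simp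

end ProductMeasure

section TreeIntegral

/-- The configuration `y` with the additional point `x`. -/
def addPoint {X α : Type*} (x : X) (y : α → X) (o : Option α) : X := o.elim x y

theorem treeSum_insertNth {X : Type*} {K : Sym2 X → ℝ≥0∞} {n : ℕ} (j : Fin (n + 1)) (z : X) (y : Fin n → X) :
    treeSum (fun e => K (e.map (j.insertNth z y : Fin (n + 1) → X))) univ =
      treeSum (fun e => K (e.map (addPoint z y))) univ := by
  have h : (univ : Finset (Fin (n + 1))) = univ.map (finSuccEquiv' j).symm.toEmbedding := by simp
  rw [h, treeSum_map]
  refine congrArg (fun w => treeSum w univ) (funext fun e => ?_)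
  rw [Sym2.map_map]
  refine congrArg (fun f => K (e.map f)) (funext fun o => ?_)
  cases o with
  | none => simp [addPoint]
  | some i => simp [addPoint]

variable {X : Type*} [MeasurableSpace X] {ν : Measure X} [SigmaFinite ν]
  {K : Sym2 X → ℝ≥0∞} {c : X → ℝ≥0∞}

theorem measurable_addPoint (n : ℕ) :
    Measurable fun p : X × (Fin n → X) => addPoint p.1 p.2 := by
  refine measurable_pi_iff.2 fun o => ?_
  cases o with
  | none => exact measurable_fst
  | some i => exact (measurable_pi_apply i).comp measurable_snd

theorem measurable_treeSum {ι : Type*} [DecidableEq ι]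
    (hK : Measurable fun p : X × X => K s(p.1, p.2)) (V : Finset ι) :
    Measurable fun x : ι → X => treeSum (fun e => K (e.map x)) V := by
  refine Finset.measurable_sum _ fun E _ => Finset.measurable_prod _ fun e _ => ?_
  induction e with | _ i j
  exact hK.comp (f := fun x : ι → X => (x i, x j))
    ((measurable_pi_apply i).prodMk (measurable_pi_apply j))

theorem measurable_prod_comp (hc : Measurable c) (n : ℕ) :
    Measurable fun x : Fin n → X => ∏ i, c (x i) :=
  Finset.measurable_prod _ fun i _ => hc.comp (measurable_pi_apply i)

/-- The integral of the tree sums, over the positions of all the points but the root `x`. -/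
def treeIntegral (ν : Measure X) (K : Sym2 X → ℝ≥0∞) (c : X → ℝ≥0∞) (n : ℕ) (x : X) : ℝ≥0∞ :=
  ∫⁻ y : Fin n → X, treeSum (fun e => K (e.map (addPoint x y))) univ * ∏ i, c (y i)
    ∂Measure.pi fun _ => ν

theorem treeIntegral_zero {X : Type*} [MeasurableSpace X] {ν : Measure X} {K : Sym2 X → ℝ≥0∞}
    {c : X → ℝ≥0∞} (x : X) : treeIntegral ν K c 0 x = 1 := by
  simp [treeIntegral]

theorem measurable_treeIntegrand (hK : Measurable fun p : X × X => K s(p.1, p.2))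
    (hc : Measurable c) (n : ℕ) : Measurable fun p : X × (Fin n → X) =>
      treeSum (fun e => K (e.map (addPoint p.1 p.2))) univ * ∏ i, c (p.2 i) :=
  ((measurable_treeSum hK _).comp (measurable_addPoint n)).mul
    ((measurable_prod_comp hc n).comp measurable_snd)

theorem measurable_treeIntegrand_right (hK : Measurable fun p : X × X => K s(p.1, p.2))
    (hc : Measurable c) (n : ℕ) (x : X) : Measurable fun y : Fin n → X =>
      treeSum (fun e => K (e.map (addPoint x y))) univ * ∏ i, c (y i) :=
  ((measurable_treeSum hK _).comp
    ((measurable_addPoint n).comp (measurable_prodMk_left (x := x)))).mul (measurable_prod_comp hc n)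

theorem measurable_treeIntegral (hK : Measurable fun p : X × X => K s(p.1, p.2))
    (hc : Measurable c) (n : ℕ) : Measurable (treeIntegral ν K c n) :=
  (measurable_treeIntegrand hK hc n).lintegral_prod_right'

theorem lintegral_mul_treeSum (hK : Measurable fun p : X × X => K s(p.1, p.2))
    (hc : Measurable c) (n : ℕ) (x : X) :
    ∫⁻ y : Fin (n + 1) → X, (∑ j, K s(x, y j)) * treeSum (fun e => K (e.map y)) univ *
        ∏ i, c (y i) ∂Measure.pi (fun _ => ν) =
      ((n + 1 : ℕ) : ℝ≥0∞) * ∫⁻ z, K s(x, z) * c z * treeIntegral ν K c n z ∂ν := by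
  have hKx : Measurable fun z => K s(x, z) := hK.comp (measurable_const.prodMk measurable_id)
  have hj : ∀ j : Fin (n + 1), ∫⁻ y : Fin (n + 1) → X, K s(x, y j) *
      treeSum (fun e => K (e.map y)) univ * ∏ i, c (y i) ∂Measure.pi (fun _ => ν) =
      ∫⁻ z, K s(x, z) * c z * treeIntegral ν K c n z ∂ν := by
    intro j
    have mp := (measurePreserving_piFinSuccAbove (fun _ : Fin (n + 1) => ν) j).symm
    rw [← mp.lintegral_comp_emb (MeasurableEquiv.measurableEmbedding _)]
    have hval : ∀ p : X × (Fin n → X),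
        (MeasurableEquiv.piFinSuccAbove (fun _ => X) j).symm p = j.insertNth p.1 p.2 := fun p => rfl
    simp only [hval, Fin.insertNth_apply_same, treeSum_insertNth, Fin.prod_univ_succAbove _ j,
      Fin.insertNth_apply_succAbove]
    rw [lintegral_prod]
    · refine lintegral_congr fun z => ?_
      rw [treeIntegral, ← lintegral_const_mul _ (measurable_treeIntegrand_right hK hc n z)]
      exact lintegral_congr fun y => by ring
    · have h1 := (measurable_treeSum hK (univ : Finset (Option (Fin n)))).comp
        (measurable_addPoint (X := X) n)
      have h2 : Measurable fun p : X × (Fin n → X) => ∏ i, c (p.2 i) :=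
        (measurable_prod_comp hc n).comp measurable_snd
      have h3 : Measurable fun p : X × (Fin n → X) => K s(x, p.1) *
          treeSum (fun e => K (e.map (addPoint p.1 p.2))) univ * (c p.1 * ∏ i, c (p.2 i)) :=
        ((hKx.comp measurable_fst).mul h1).mul ((hc.comp measurable_fst).mul h2)
      exact h3.aemeasurable
  simp only [sum_mul]
  rw [lintegral_finsetSum]
  · simp [hj]
  · intro j _
    exact ((hKx.comp (measurable_pi_apply j)).mul (measurable_treeSum hK _)).mul
      (measurable_prod_comp hc _)

/-- Splitting the tree integrals at the root. -/
theorem treeIntegral_succ_le (hK : Measurable fun p : X × X => K s(p.1, p.2))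
    (hc : Measurable c) (n : ℕ) (x : X) :
    treeIntegral ν K c (n + 1) x ≤ ∑ k ∈ range (n + 1), (n.choose k : ℝ≥0∞) *
      (((k + 1 : ℕ) : ℝ≥0∞) * (∫⁻ z, K s(x, z) * c z * treeIntegral ν K c k z ∂ν) *
        treeIntegral ν K c (n - k) x) := by
  have hKx : Measurable fun z => K s(x, z) := hK.comp (measurable_const.prodMk measurable_id)
  set V : Finset (Fin (n + 1)) := univ.erase 0 with hV
  -- the pointwise bound
  have hpt : ∀ y : Fin (n + 1) → X, treeSum (fun e => K (e.map (addPoint x y))) univ ≤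
      ∑ S ∈ V.powerset, (∑ j ∈ insert 0 S, K s(x, y j)) *
        treeSum (fun e => K (e.map y)) (insert 0 S) *
        treeSum (fun e => K (e.map (addPoint x y)))
          (insert none ((insert 0 S)ᶜ.map Function.Embedding.some)) := by
    intro y
    have huniv : (univ : Finset (Option (Fin (n + 1)))) =
        insert none (insert (some 0) (V.map Function.Embedding.some)) := by
      ext o
      cases o with
      | none => simp
      | some i => simp [hV]
    rw [huniv]
    refine (treeSum_insert_insert_le (fun _ => zero_le) (by simp) (by simp [hV]) (by simp)).trans ?_
    apply le_of_eq
    symm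
    refine sum_bij (fun S _ => S.map Function.Embedding.some) ?_ ?_ ?_ ?_
    · intro S hS
      simpa using hS
    · intro S _ T _ h
      simpa using h
    · intro T hT
      obtain ⟨S, hS, rfl⟩ := subset_map_iff.1 (mem_powerset.1 hT)
      exact ⟨S, mem_powerset.2 hS, rfl⟩
    · intro S hS
      have h1 : insert (some 0) (S.map Function.Embedding.some) =
          (insert 0 S).map Function.Embedding.some := by simp
      rw [h1, sum_map, treeSum_map, compl_insert_zero, Finset.map_sdiff]
      congr 2
      refine congrArg (fun w => treeSum w (insert 0 S)) (funext fun e => ?_)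
      rw [Sym2.map_map]
      rfl
  have hmeas : ∀ S ∈ V.powerset, Measurable fun y : Fin (n + 1) → X =>
      (∑ j ∈ insert 0 S, K s(x, y j)) * treeSum (fun e => K (e.map y)) (insert 0 S) *
        treeSum (fun e => K (e.map (addPoint x y)))
          (insert none ((insert 0 S)ᶜ.map Function.Embedding.some)) * ∏ i, c (y i) := by
    intro S _
    have h1 := (measurable_treeSum hK
      (insert none ((insert 0 S)ᶜ.map Function.Embedding.some))).comp
        ((measurable_addPoint (X := X) (n + 1)).comp (measurable_prodMk_left (x := x)))
    exact (((Finset.measurable_sum _ fun j _ => hKx.comp (measurable_pi_apply j)).mul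
      (measurable_treeSum hK _)).mul h1).mul (measurable_prod_comp hc _)
  calc treeIntegral ν K c (n + 1) x
      ≤ ∫⁻ y : Fin (n + 1) → X, ∑ S ∈ V.powerset, (∑ j ∈ insert 0 S, K s(x, y j)) *
          treeSum (fun e => K (e.map y)) (insert 0 S) *
          treeSum (fun e => K (e.map (addPoint x y)))
            (insert none ((insert 0 S)ᶜ.map Function.Embedding.some)) *
          ∏ i, c (y i) ∂Measure.pi fun _ => ν := by
        refine lintegral_mono fun y => ?_
        rw [← sum_mul]
        gcongr
        exact hpt y
    _ = ∑ S ∈ V.powerset, ∫⁻ y : Fin (n + 1) → X, (∑ j ∈ insert 0 S, K s(x, y j)) *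
          treeSum (fun e => K (e.map y)) (insert 0 S) *
          treeSum (fun e => K (e.map (addPoint x y)))
            (insert none ((insert 0 S)ᶜ.map Function.Embedding.some)) *
          ∏ i, c (y i) ∂Measure.pi fun _ => ν := lintegral_finsetSum _ hmeas
    _ = _ := by
        refine sum_powerset_erase_zero _ (fun k => ((k + 1 : ℕ) : ℝ≥0∞) *
          (∫⁻ z, K s(x, z) * c z * treeIntegral ν K c k z ∂ν) * treeIntegral ν K c (n - k) x)
          fun S hS => ?_
        have hk := card_insert_zero hS
        have hm := card_compl_insert_zero hS
        set e := finSumEquivOfFinset hk hm with he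
        have e1 := map_finSumEquivOfFinset_inl hk hm
        have e2 := map_finSumEquivOfFinset_inr hk hm
        rw [← lintegral_mul_treeSum hK hc, treeIntegral, ← lintegral_prod_mul,
          ← (measurePreserving_split ν e).lintegral_comp]
        · refine lintegral_congr fun y => ?_
          have p1 : ∏ i, c (y i) = (∏ i, c (y (e (Sum.inl i)))) * ∏ i, c (y (e (Sum.inr i))) := by
            rw [← Equiv.prod_comp e, Fintype.prod_sum_type]
          have p2 : ∑ j ∈ insert 0 S, K s(x, y j) = ∑ j, K s(x, y (e (Sum.inl j))) := by
            rw [← e1, sum_map]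
            rfl
          have p3 : treeSum (fun e => K (e.map y)) (insert 0 S) =
              treeSum (fun f => K (f.map fun i => y (e (Sum.inl i)))) univ := by
            rw [← e1, treeSum_map]
            refine congrArg (fun w => treeSum w univ) (funext fun f => ?_)
            rw [Sym2.map_map]
            rfl
          have p4 : treeSum (fun e => K (e.map (addPoint x y)))
              (insert none ((insert 0 S)ᶜ.map Function.Embedding.some)) =
              treeSum (fun f => K (f.map (addPoint x fun i => y (e (Sum.inr i))))) univ := by
            have q : insert none ((insert 0 S)ᶜ.map Function.Embedding.some) =
                (univ : Finset (Option (Fin (n - S.card)))).map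
                  (Function.Embedding.optionMap (Function.Embedding.inr.trans e.toEmbedding)) := by
              rw [← e2]
              ext o
              cases o with
              | none => simp
              | some i => simp [he]
            rw [q, treeSum_map]
            refine congrArg (fun w => treeSum w univ) (funext fun f => ?_)
            rw [Sym2.map_map]
            refine congrArg (fun g => K (f.map g)) (funext fun o => ?_)
            cases o <;> rfl
          rw [p1, p2, p3, p4]
          ring
        · exact (((((Finset.measurable_sum _ fun j _ => hKx.comp (measurable_pi_apply j)).mul
            (measurable_treeSum hK _)).mul (measurable_prod_comp hc _)).comp measurable_fst).mul
            ((measurable_treeIntegrand_right hK hc _ x).comp measurable_snd))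
        · exact (((Finset.measurable_sum _ fun j _ => hKx.comp (measurable_pi_apply j)).mul
            (measurable_treeSum hK _)).mul (measurable_prod_comp hc _)).aemeasurable
        · exact (measurable_treeIntegrand_right hK hc _ x).aemeasurable

end TreeIntegral

end ClusterExpansion

end

noncomputable section

namespace ClusterExpansion

open Finset

section TreeBound

variable {X : Type*} [MeasurableSpace X] {ν : Measure X} [SigmaFinite ν]
  {K : Sym2 X → ℝ≥0∞} {c : X → ℝ≥0∞}

theorem ennreal_factorial_ne_zero (n : ℕ) : ((n ! : ℕ) : ℝ≥0∞) ≠ 0 :=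
  Nat.cast_ne_zero.2 n.factorial_ne_zero

theorem ennreal_factorial_mul_inv (n : ℕ) : ((n ! : ℕ) : ℝ≥0∞) * ((n ! : ℕ) : ℝ≥0∞)⁻¹ = 1 :=
  ENNReal.mul_inv_cancel (ennreal_factorial_ne_zero n) (ENNReal.natCast_ne_top _)

theorem succ_mul_inv_factorial_succ (n : ℕ) :
    ((n + 1 : ℕ) : ℝ≥0∞) * (((n + 1)! : ℕ) : ℝ≥0∞)⁻¹ = ((n ! : ℕ) : ℝ≥0∞)⁻¹ := by
  rw [Nat.factorial_succ, Nat.cast_mul, ENNReal.mul_inv (.inr (ENNReal.natCast_ne_top _))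
    (.inl (ENNReal.natCast_ne_top _)), ← mul_assoc, ENNReal.mul_inv_cancel
    (Nat.cast_ne_zero.2 n.succ_ne_zero) (ENNReal.natCast_ne_top _), one_mul]

theorem succ_mul_treeIntegral_succ_le (hK : Measurable fun p : X × X => K s(p.1, p.2))
    (hc : Measurable c) (n : ℕ) (x : X) :
    ((n + 1 : ℕ) : ℝ≥0∞) * ((((n + 1)! : ℕ) : ℝ≥0∞)⁻¹ * treeIntegral ν K c (n + 1) x) ≤
      ∑ k ∈ range (n + 1), ((k + 1 : ℕ) : ℝ≥0∞) *
        (∫⁻ z, K s(x, z) * c z * (((k ! : ℕ) : ℝ≥0∞)⁻¹ * treeIntegral ν K c k z) ∂ν) *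
        ((((n - k)! : ℕ) : ℝ≥0∞)⁻¹ * treeIntegral ν K c (n - k) x) := by
  have hKx : Measurable fun z => K s(x, z) := hK.comp (measurable_const.prodMk measurable_id)
  rw [← mul_assoc, succ_mul_inv_factorial_succ]
  refine (mul_le_mul_right (treeIntegral_succ_le hK hc n x) _).trans (le_of_eq ?_)
  rw [mul_sum]
  refine sum_congr rfl fun k hk => ?_
  have hkn : k ≤ n := Nat.lt_succ_iff.1 (mem_range.1 hk)
  have hI : ∫⁻ z, K s(x, z) * c z * (((k ! : ℕ) : ℝ≥0∞)⁻¹ * treeIntegral ν K c k z) ∂ν =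
      ((k ! : ℕ) : ℝ≥0∞)⁻¹ * ∫⁻ z, K s(x, z) * c z * treeIntegral ν K c k z ∂ν := by
    have hm : Measurable fun z => K s(x, z) * c z * treeIntegral ν K c k z :=
      (hKx.mul hc).mul (measurable_treeIntegral hK hc k)
    rw [← lintegral_const_mul _ hm]
    exact lintegral_congr fun z => by ring
  have hchoose : ((n ! : ℕ) : ℝ≥0∞)⁻¹ * (n.choose k : ℝ≥0∞) =
      ((k ! : ℕ) : ℝ≥0∞)⁻¹ * (((n - k)! : ℕ) : ℝ≥0∞)⁻¹ := by
    have h : (n.choose k : ℝ≥0∞) * ((k ! : ℕ) : ℝ≥0∞) * (((n - k)! : ℕ) : ℝ≥0∞) =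
        ((n ! : ℕ) : ℝ≥0∞) := by
      exact_mod_cast Nat.choose_mul_factorial_mul_factorial hkn
    calc ((n ! : ℕ) : ℝ≥0∞)⁻¹ * (n.choose k : ℝ≥0∞)
        = ((n ! : ℕ) : ℝ≥0∞)⁻¹ * (n.choose k : ℝ≥0∞) *
          (((k ! : ℕ) : ℝ≥0∞) * ((k ! : ℕ) : ℝ≥0∞)⁻¹) *
          ((((n - k)! : ℕ) : ℝ≥0∞) * (((n - k)! : ℕ) : ℝ≥0∞)⁻¹) := by
          rw [ennreal_factorial_mul_inv, ennreal_factorial_mul_inv, mul_one, mul_one]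
      _ = ((n.choose k : ℝ≥0∞) * ((k ! : ℕ) : ℝ≥0∞) * (((n - k)! : ℕ) : ℝ≥0∞) *
          ((n ! : ℕ) : ℝ≥0∞)⁻¹) * (((k ! : ℕ) : ℝ≥0∞)⁻¹ * (((n - k)! : ℕ) : ℝ≥0∞)⁻¹) := by ring
      _ = _ := by rw [h, ennreal_factorial_mul_inv, one_mul]
  rw [hI, ← mul_assoc, hchoose]
  ring

/-- The sums over rooted trees are bounded by the solution of the fixed point inequality. -/
theorem sum_treeIntegral_le (hK : Measurable fun p : X × X => K s(p.1, p.2))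
    (hc : Measurable c) {a : X → ℝ} (ha : ∀ x, 0 ≤ a x)
    (hcrit : ∀ᵐ x ∂ν, ∫⁻ z, K s(x, z) * c z * ENNReal.ofReal (Real.exp (a z)) ∂ν ≤
      ENNReal.ofReal (a x)) (N : ℕ) :
    ∀ᵐ x ∂ν, ∑ n ∈ range (N + 1), ((n ! : ℕ) : ℝ≥0∞)⁻¹ * treeIntegral ν K c n x ≤
      ENNReal.ofReal (Real.exp (a x)) := by
  induction N with
  | zero =>
    refine .of_forall fun x => ?_
    simpa [treeIntegral_zero] using ha x
  | succ N ih =>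
    filter_upwards [hcrit] with x hx
    have hKx : Measurable fun z => K s(x, z) := hK.comp (measurable_const.prodMk measurable_id)
    refine sum_range_le_ofReal_exp (by simp [treeIntegral_zero]) (N + 1)
      (B := fun k => ∫⁻ z, K s(x, z) * c z *
        (((k ! : ℕ) : ℝ≥0∞)⁻¹ * treeIntegral ν K c k z) ∂ν) ?_ (ha x)
      fun n _ => succ_mul_treeIntegral_succ_le hK hc n x
    refine le_trans ?_ hx
    rw [← lintegral_finsetSum]
    · refine lintegral_mono_ae ?_
      filter_upwards [ih] with z hz
      rw [← mul_sum]
      gcongr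
    · intro k _
      exact (hKx.mul hc).mul ((measurable_treeIntegral hK hc k).const_mul _)

theorem tsum_treeIntegral_le (hK : Measurable fun p : X × X => K s(p.1, p.2))
    (hc : Measurable c) {a : X → ℝ} (ha : ∀ x, 0 ≤ a x)
    (hcrit : ∀ᵐ x ∂ν, ∫⁻ z, K s(x, z) * c z * ENNReal.ofReal (Real.exp (a z)) ∂ν ≤
      ENNReal.ofReal (a x)) :
    ∀ᵐ x ∂ν, ∑' n : ℕ, (((n + 1)! : ℕ) : ℝ≥0∞)⁻¹ * treeIntegral ν K c (n + 1) x ≤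
      ENNReal.ofReal (Real.exp (a x) - 1) := by
  filter_upwards [ae_all_iff.2 (sum_treeIntegral_le hK hc ha hcrit)] with x hx
  rw [ENNReal.tsum_eq_iSup_nat]
  refine iSup_le fun N => ?_
  have h := hx N
  rw [sum_range_succ'] at h
  rw [ENNReal.ofReal_sub _ zero_le_one, ENNReal.ofReal_one]
  refine ENNReal.le_sub_of_add_le_right ENNReal.one_ne_top ?_
  simpa [treeIntegral_zero] using h

end TreeBound

end ClusterExpansion

end

noncomputable section

namespace ClusterExpansion

section ComplexMeasure

variable {X : Type*} [MeasurableSpace X]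

theorem withDensityᵥ_rnDeriv_variation (μ : ComplexMeasure X) [IsFiniteMeasure μ.variation] :
    μ.variation.withDensityᵥ (μ.rnDeriv μ.variation) = μ := by
  have hzero : ∀ s, μ.variation.toENNRealVectorMeasure s = 0 → μ s = 0 := by
    intro s hs
    by_cases hsm : MeasurableSet s
    · rw [Measure.toENNRealVectorMeasure_apply_measurable hsm] at hs
      have := μ.enorm_measure_le_variation s
      rw [hs] at this
      simpa using this
    · exact μ.not_measurable hsm
  have hre := SignedMeasure.withDensityᵥ_rnDeriv_eq (ComplexMeasure.re μ) μ.variation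
    fun s hs => congrArg Complex.re (hzero s hs)
  have him := SignedMeasure.withDensityᵥ_rnDeriv_eq (ComplexMeasure.im μ) μ.variation
    fun s hs => congrArg Complex.im (hzero s hs)
  ext s hs
  have hi := μ.integrable_rnDeriv μ.variation
  rw [withDensityᵥ_apply hi hs]
  apply Complex.ext
  · have h := congrArg (fun m : SignedMeasure X => m s) hre
    rw [withDensityᵥ_apply (SignedMeasure.integrable_rnDeriv _ _) hs] at h
    rw [← RCLike.re_eq_complex_re, ← integral_re hi.integrableOn]
    exact h
  · have h := congrArg (fun m : SignedMeasure X => m s) him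
    rw [withDensityᵥ_apply (SignedMeasure.integrable_rnDeriv _ _) hs] at h
    rw [← RCLike.im_eq_complex_im, ← integral_im hi.integrableOn]
    exact h

/-- The polar decomposition of a complex measure. -/
theorem exists_polar (μ : ComplexMeasure X) [IsFiniteMeasure μ.variation] :
    ∃ h : X → ℂ, Measurable h ∧ (∀ x, ‖h x‖ = 1) ∧ μ.variation.withDensityᵥ h = μ := by
  classical
  set g := μ.rnDeriv μ.variation with hg
  have hi : Integrable g μ.variation := μ.integrable_rnDeriv μ.variation
  have hgm : Measurable g := by
    have h : g = fun x => (((ComplexMeasure.re μ).rnDeriv μ.variation x : ℝ) : ℂ) +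
        ((ComplexMeasure.im μ).rnDeriv μ.variation x : ℝ) * Complex.I := by
      ext x
      apply Complex.ext <;> simp [hg, ComplexMeasure.rnDeriv]
    rw [h]
    exact (Complex.measurable_ofReal.comp (SignedMeasure.measurable_rnDeriv _ _)).add
      ((Complex.measurable_ofReal.comp (SignedMeasure.measurable_rnDeriv _ _)).mul_const _)
  have hμ := withDensityᵥ_rnDeriv_variation μ
  have hvar := Measure.variation_withDensityᵥ hi
  rw [hμ] at hvar
  have h1 : (fun x => ‖g x‖ₑ) =ᵐ[μ.variation] fun _ => 1 := by
    refine (withDensity_eq_iff_of_sigmaFinite hgm.enorm.aemeasurable aemeasurable_const).1 ?_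
    rw [← hvar]
    exact withDensity_one.symm
  refine ⟨fun x => if ‖g x‖ = 1 then g x else 1, ?_, fun x => ?_, ?_⟩
  · exact Measurable.ite (hgm.norm (measurableSet_singleton 1)) hgm measurable_const
  · dsimp only
    split_ifs with h
    · exact h
    · simp
  · conv_rhs => rw [← hμ]
    refine WithDensityᵥEq.congr_ae ?_
    filter_upwards [h1] with x hx
    have : ‖g x‖ = 1 := by simpa [enorm_eq_nnnorm, ← NNReal.coe_eq_one] using hx
    rw [if_pos this]

theorem vectorIntegral_eq_integral_mul {μ : ComplexMeasure X} [IsFiniteMeasure μ.variation]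
    {h : X → ℂ} (hm : Measurable h) (hn : ∀ x, ‖h x‖ = 1)
    (hμ : μ.variation.withDensityᵥ h = μ) {f : X → ℂ} (hf : Integrable f μ.variation) :
    VectorMeasure.integral μ f (ContinuousLinearMap.mul ℝ ℂ) = ∫ x, f x * h x ∂μ.variation := by
  have hb : ∀ f : X → ℂ, Integrable f μ.variation →
      Integrable (fun x => f x * h x) μ.variation := fun f hf =>
    hf.mul_bdd (c := 1) hm.aestronglyMeasurable (.of_forall fun x => (hn x).le)
  have hi : Integrable h μ.variation := by simpa using hb (fun _ => 1) (integrable_const 1)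
  refine Integrable.induction (fun f => VectorMeasure.integral μ f (ContinuousLinearMap.mul ℝ ℂ) =
    ∫ x, f x * h x ∂μ.variation) ?_ ?_ ?_ ?_ hf
  · intro c s hs _
    have h1 : ∀ x, s.indicator (fun _ => c) x * h x = s.indicator (fun x => c * h x) x := by
      intro x
      by_cases hx : x ∈ s <;> simp [hx]
    simp_rw [h1]
    rw [integral_indicator hs, integral_const_mul, VectorMeasure.integral_indicator_const c hs]
    have := withDensityᵥ_apply hi hs
    rw [hμ] at this
    rw [this]
    rfl
  · intro f g _ hf hg hfe hge
    rw [VectorMeasure.integral_add hf hg, hfe, hge, ← integral_add (hb f hf) (hb g hg)]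
    exact integral_congr_ae (.of_forall fun x => by simp [add_mul])
  · refine isClosed_eq VectorMeasure.continuous_integral ?_
    refine LipschitzWith.continuous (K := 1) (LipschitzWith.of_dist_le_mul fun f g => ?_)
    rw [dist_eq_norm, dist_eq_norm, ← integral_sub (hb _ (L1.integrable_coeFn f))
      (hb _ (L1.integrable_coeFn g)), L1.norm_eq_integral_norm, NNReal.coe_one, one_mul]
    refine (norm_integral_le_integral_norm _).trans (le_of_eq (integral_congr_ae ?_))
    filter_upwards [Lp.coeFn_sub f g] with x hx
    rw [hx, Pi.sub_apply, ← sub_mul, norm_mul, hn, mul_one]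
  · intro f g hfg _ hf
    rw [← VectorMeasure.integral_congr_ae hfg, hf]
    exact integral_congr_ae (hfg.mono fun x hx => by simp only [hx])

theorem integrable_mul_prod_phase {ν : Measure X} [IsFiniteMeasure ν] {h : X → ℂ}
    (hm : Measurable h) (hn : ∀ x, ‖h x‖ = 1) {ι : Type*} [Fintype ι] {f : (ι → X) → ℂ}
    (hf : Integrable f (Measure.pi fun _ => ν)) :
    Integrable (fun x => f x * ∏ i, h (x i)) (Measure.pi fun _ => ν) := by
  refine hf.mul_bdd (c := 1) (Measurable.aestronglyMeasurable ?_) (.of_forall fun x => ?_)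
  · exact Finset.measurable_prod _ fun i _ => hm.comp (measurable_pi_apply i)
  · simp [hn]

instance isFiniteMeasure_absPi (μ : ComplexMeasure X) [IsFiniteMeasure μ.variation] (n : ℕ) :
    IsFiniteMeasure (absPi μ n) :=
  inferInstanceAs (IsFiniteMeasure (Measure.pi fun _ : Fin n => μ.variation))

theorem coe_piFinSuccAbove_symm_zero (n : ℕ) :
    ⇑(MeasurableEquiv.piFinSuccAbove (fun _ : Fin (n + 1) => X) 0).symm =
      fun p : X × (Fin n → X) => (Fin.cons p.1 p.2 : Fin (n + 1) → X) := by
  ext p i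
  change (Fin.insertNth 0 p.1 p.2 : Fin (n + 1) → X) i = _
  rw [Fin.insertNth_zero']

theorem measurableEmbedding_cons (n : ℕ) :
    MeasurableEmbedding fun p : X × (Fin n → X) => (Fin.cons p.1 p.2 : Fin (n + 1) → X) := by
  rw [← coe_piFinSuccAbove_symm_zero]
  exact MeasurableEquiv.measurableEmbedding _

theorem measurePreserving_cons (ν : Measure X) [SigmaFinite ν] (n : ℕ) :
    MeasurePreserving (fun p : X × (Fin n → X) => (Fin.cons p.1 p.2 : Fin (n + 1) → X))
      (ν.prod (Measure.pi fun _ => ν)) (Measure.pi fun _ => ν) := by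
  rw [← coe_piFinSuccAbove_symm_zero]
  exact (measurePreserving_piFinSuccAbove (fun _ : Fin (n + 1) => ν) 0).symm

/-- Iterated integrals against a complex measure, in terms of its polar decomposition. -/
theorem iterIntegral_eq {μ : ComplexMeasure X} [IsFiniteMeasure μ.variation]
    {h : X → ℂ} (hm : Measurable h) (hn : ∀ x, ‖h x‖ = 1)
    (hμ : μ.variation.withDensityᵥ h = μ) {n : ℕ} {f : (Fin n → X) → ℂ}
    (hf : Integrable f (absPi μ n)) :
    iterIntegral μ n f = ∫ x, f x * ∏ i, h (x i) ∂absPi μ n := by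
  induction n with
  | zero =>
    rw [iterIntegral, absPi, Measure.pi_of_empty]
    simp
    congr
  | succ n ih =>
    have mp : MeasurePreserving (fun p : X × (Fin n → X) => (Fin.cons p.1 p.2 : Fin (n + 1) → X))
      (μ.variation.prod (absPi μ n)) (absPi μ (n + 1)) := measurePreserving_cons μ.variation n
    have emb := measurableEmbedding_cons (X := X) n
    have hf1 : Integrable (fun p : X × (Fin n → X) => f (Fin.cons p.1 p.2))
        (μ.variation.prod (absPi μ n)) := (mp.integrable_comp_emb emb).2 hf
    have hf2 : Integrable (fun p : X × (Fin n → X) => f (Fin.cons p.1 p.2) *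
        (h p.1 * ∏ i, h (p.2 i))) (μ.variation.prod (absPi μ n)) := by
      have := (mp.integrable_comp_emb emb).2 (integrable_mul_prod_phase hm hn hf)
      simpa only [Function.comp_def, Fin.prod_univ_succ, Fin.cons_zero, Fin.cons_succ]
        using this
    have hf3 : Integrable (fun p : X × (Fin n → X) => f (Fin.cons p.1 p.2) * ∏ i, h (p.2 i))
        (μ.variation.prod (absPi μ n)) := by
      refine hf1.mul_bdd (c := 1) (Measurable.aestronglyMeasurable ?_) (.of_forall fun x => ?_)
      · exact Finset.measurable_prod _ fun i _ =>
          hm.comp ((measurable_pi_apply i).comp measurable_snd)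
      · simp [hn]
    have hslice : (fun x => iterIntegral μ n fun y => f (Fin.cons x y)) =ᵐ[μ.variation]
        fun x => ∫ y, f (Fin.cons x y) * ∏ i, h (y i) ∂absPi μ n := by
      filter_upwards [hf1.prod_right_ae] with x hx using ih hx
    rw [iterIntegral, VectorMeasure.integral_congr_ae hslice,
      vectorIntegral_eq_integral_mul hm hn hμ hf3.integral_prod_left]
    have hR : ∫ x, f x * ∏ i, h (x i) ∂absPi μ (n + 1) = ∫ p : X × (Fin n → X),
        f (Fin.cons p.1 p.2) * (h p.1 * ∏ i, h (p.2 i)) ∂μ.variation.prod (absPi μ n) := by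
      rw [← mp.integral_comp emb (fun x : Fin (n + 1) → X => f x * ∏ i, h (x i))]
      simp only [Fin.prod_univ_succ, Fin.cons_zero, Fin.cons_succ]
    rw [hR, integral_prod _ hf2]
    refine integral_congr_ae (.of_forall fun x => ?_)
    dsimp only
    rw [← integral_mul_const]
    exact integral_congr_ae (.of_forall fun y => by ring)

end ComplexMeasure

end ClusterExpansion

end

noncomputable section

namespace ClusterExpansion

open Finset

section Measurability

theorem measurable_of_measurable_coe {β : Type*} [MeasurableSpace β] {f : WithTop ℂ → β}
    (h : Measurable fun z : ℂ => f z) : Measurable f := fun _ hs => h hs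

theorem measurable_expNeg : Measurable expNeg :=
  measurable_of_measurable_coe (Complex.measurable_exp.comp measurable_neg)

theorem measurable_untopD (w : ℂ) : Measurable fun z : WithTop ℂ => z.untopD w :=
  measurable_of_measurable_coe measurable_id

variable {X : Type*} [MeasurableSpace X] {u : X → X → WithTop ℂ} (hu : ∀ x y, u x y = u y x)

theorem measurable_edgeZeta {ι : Type*} (hm : Measurable fun p : X × X => u p.1 p.2)
    (e : Sym2 ι) : Measurable fun x : ι → X => edgeZeta hu x e := by
  induction e with | _ i j
  exact ((measurable_expNeg.comp hm).sub_const 1).comp (f := fun x : ι → X => (x i, x j))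
    ((measurable_pi_apply i).prodMk (measurable_pi_apply j))

theorem measurable_boltzmann (hu : ∀ x y, u x y = u y x)
    (hm : Measurable fun p : X × X => u p.1 p.2) (n : ℕ) :
    Measurable fun x : Fin n → X => boltzmann u x := by
  simp only [boltzmann_eq_fullProd hu]
  exact Finset.measurable_prod _ fun e _ => (measurable_edgeZeta hu hm e).const_add 1

theorem measurable_connSum (hm : Measurable fun p : X × X => u p.1 p.2) {ι : Type*}
    [DecidableEq ι] (V : Finset ι) :
    Measurable fun x : ι → X => connSum (edgeZeta hu x) V :=
  Finset.measurable_sum _ fun _ _ => Finset.measurable_prod _ fun e _ => measurable_edgeZeta hu hm e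

theorem measurable_phi (hu : ∀ x y, u x y = u y x)
    (hm : Measurable fun p : X × X => u p.1 p.2) (n : ℕ) :
    Measurable fun x : Fin (n + 1) → X => phi u x := by
  simp only [phi_eq_connSum hu]
  exact (measurable_connSum hu hm _).const_mul _

end Measurability

section Stability

variable {X : Type*} [MeasurableSpace X] {u : X → X → WithTop ℂ} (hu : ∀ x y, u x y = u y x)
  {μ : ComplexMeasure X} [IsFiniteMeasure μ.variation] {b : X → ℝ}

/-- Stability holds, almost surely, for all the subconfigurations. -/
theorem Stable.ae_forall (hst : Stable μ u b) (n : ℕ) :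
    ∀ᵐ x ∂absPi μ n, ∀ V : Finset (Fin n),
      ∏ e ∈ edges V, ‖1 + edgeZeta hu x e‖ ≤ ∏ i ∈ V, Real.exp (b (x i)) := by
  rw [ae_all_iff]
  intro V
  set e := finSumEquivOfFinset (rfl : V.card = V.card) (rfl : Vᶜ.card = Vᶜ.card) with he
  have hV := map_finSumEquivOfFinset_inl (rfl : V.card = V.card) (rfl : Vᶜ.card = Vᶜ.card)
  have h1 := (measurePreserving_split μ.variation e).quasiMeasurePreserving.ae
    (Measure.quasiMeasurePreserving_fst.ae (hst V.card))
  filter_upwards [h1] with x hx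
  have h2 := prod_pairs (fun f => ‖1 + edgeZeta hu (fun i => x (e (Sum.inl i))) f‖)
  simp only [edgeZeta_mk] at h2
  rw [h2] at hx
  rw [← hV, edges_map, prod_map, prod_map]
  refine (le_of_eq (prod_congr rfl fun f _ => ?_)).trans hx
  induction f with | _ i j
  rfl

theorem ofReal_treeSum {ι : Type*} [DecidableEq ι] {w : Sym2 ι → ℝ} (hw : ∀ e, 0 ≤ w e)
    (V : Finset ι) : ENNReal.ofReal (treeSum w V) = treeSum (fun e => ENNReal.ofReal (w e)) V := by
  rw [treeSum, treeSum, ENNReal.ofReal_sum_of_nonneg fun _ _ => prod_nonneg fun e _ => hw e]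
  exact sum_congr rfl fun _ _ => ENNReal.ofReal_prod_of_nonneg fun e _ => hw e

theorem Stable.ae_connSum_le_zeta (hst : Stable μ u b) (n : ℕ) :
    ∀ᵐ x ∂absPi μ (n + 1), ENNReal.ofReal ‖connSum (edgeZeta hu x) univ‖ ≤
      (∏ i, ENNReal.ofReal (Real.exp (2 * b (x i)))) *
        treeSum (fun e => ENNReal.ofReal ‖edgeZeta hu x e‖) univ := by
  filter_upwards [hst.ae_forall hu (n + 1)] with x hx
  refine (ENNReal.ofReal_le_ofReal
    (norm_connSum_le_treeSum_zeta (b := fun i => b (x i)) hx univ_nonempty)).trans (le_of_eq ?_)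
  rw [ENNReal.ofReal_mul (prod_nonneg fun _ _ => (Real.exp_pos _).le),
    ofReal_treeSum fun _ => norm_nonneg _,
    ENNReal.ofReal_prod_of_nonneg fun _ _ => (Real.exp_pos _).le]

theorem Stable.ae_connSum_le_ubar (hst : Stable μ u b) (hb : ∀ x, 0 ≤ b x) (n : ℕ) :
    ∀ᵐ x ∂absPi μ (n + 1), ENNReal.ofReal ‖connSum (edgeZeta hu x) univ‖ ≤
      (∏ i, ENNReal.ofReal (Real.exp (b (x i)))) *
        treeSum (fun e => ENNReal.ofReal ‖edgeUbar hu x e‖) univ := by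
  filter_upwards [hst.ae_forall hu (n + 1)] with x hx
  simp only [edgeZeta, add_sub_cancel] at hx
  refine (ENNReal.ofReal_le_ofReal (norm_connSum_le_treeSum_ubar (b := fun i => b (x i))
    (fun i => hb _) hx univ_nonempty)).trans (le_of_eq ?_)
  rw [ENNReal.ofReal_mul (prod_nonneg fun _ _ => (Real.exp_pos _).le),
    ofReal_treeSum fun _ => norm_nonneg _,
    ENNReal.ofReal_prod_of_nonneg fun _ _ => (Real.exp_pos _).le]
  rfl

theorem ofReal_norm_phi {X : Type*} {u : X → X → WithTop ℂ} (hu : ∀ x y, u x y = u y x)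
    {n : ℕ} (x : Fin (n + 1) → X) : ENNReal.ofReal ‖phi u x‖ =
    (((n + 1)! : ℕ) : ℝ≥0∞)⁻¹ * ENNReal.ofReal ‖connSum (edgeZeta hu x) univ‖ := by
  rw [phi_eq_connSum hu, norm_mul, norm_inv, Complex.norm_natCast,
    ENNReal.ofReal_mul (by positivity), ENNReal.ofReal_inv_of_pos (by positivity),
    ENNReal.ofReal_natCast]

/-- A bound on the rooted cluster sums from a tree-graph inequality. -/
theorem rootedClusterSum_le {K : Sym2 X → ℝ≥0∞} {c : X → ℝ≥0∞}
    (hK : Measurable fun p : X × X => K s(p.1, p.2)) (hc : Measurable c)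
    (hle : ∀ n, ∀ᵐ x ∂absPi μ (n + 1), ENNReal.ofReal ‖connSum (edgeZeta hu x) univ‖ ≤
      (∏ i, c (x i)) * treeSum (fun e => K (e.map x)) univ)
    {a : X → ℝ} (ha : ∀ x, 0 ≤ a x)
    (hcrit : ∀ᵐ x ∂μ.variation, ∫⁻ z, K s(x, z) * c z * ENNReal.ofReal (Real.exp (a z))
      ∂μ.variation ≤ ENNReal.ofReal (a x)) :
    ∀ᵐ x ∂μ.variation, rootedClusterSum μ u x ≤ c x * ENNReal.ofReal (Real.exp (a x) - 1) := by
  have hslice : ∀ᵐ x ∂μ.variation, ∀ m : ℕ, ∀ᵐ y ∂absPi μ (m + 1),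
      ENNReal.ofReal ‖connSum (edgeZeta hu (Fin.cons x y : Fin (m + 2) → X)) univ‖ ≤
      (∏ i, c ((Fin.cons x y : Fin (m + 2) → X) i)) *
        treeSum (fun e => K (e.map (Fin.cons x y : Fin (m + 2) → X))) univ :=
    ae_all_iff.2 fun m => Measure.ae_ae_of_ae_prod
      ((measurePreserving_cons μ.variation (m + 1)).quasiMeasurePreserving.ae (hle (m + 1)))
  filter_upwards [hslice, tsum_treeIntegral_le hK hc ha hcrit] with x hx hsum
  refine le_trans ?_ (mul_le_mul_right hsum _)
  rw [rootedClusterSum, ← ENNReal.tsum_mul_left]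
  refine ENNReal.tsum_le_tsum fun m => ?_
  calc ((m + 2 : ℕ) : ℝ≥0∞) * ∫⁻ y : Fin (m + 1) → X,
        ENNReal.ofReal ‖phi u (Fin.cons x y : Fin (m + 2) → X)‖ ∂absPi μ (m + 1)
      ≤ ((m + 2 : ℕ) : ℝ≥0∞) * ∫⁻ y : Fin (m + 1) → X, (((m + 2)! : ℕ) : ℝ≥0∞)⁻¹ * c x *
          (treeSum (fun e => K (e.map (addPoint x y))) univ * ∏ i, c (y i)) ∂absPi μ (m + 1) := by
        refine mul_le_mul_right (lintegral_mono_ae ?_) _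
        filter_upwards [hx m] with y hy
        rw [ofReal_norm_phi hu, mul_assoc]
        gcongr
        refine hy.trans (le_of_eq ?_)
        rw [Fin.prod_univ_succ, ← Fin.insertNth_zero', treeSum_insertNth]
        simp only [Fin.insertNth_zero', Fin.cons_zero, Fin.cons_succ]
        ring
    _ = ((m + 2 : ℕ) : ℝ≥0∞) * ((((m + 2)! : ℕ) : ℝ≥0∞)⁻¹ * c x *
          treeIntegral μ.variation K c (m + 1) x) := by
        rw [lintegral_const_mul _ (measurable_treeIntegrand_right hK hc _ x)]
        rfl
    _ = c x * ((((m + 1)! : ℕ) : ℝ≥0∞)⁻¹ * treeIntegral μ.variation K c (m + 1) x) := by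
        rw [← succ_mul_inv_factorial_succ (m + 1)]
        ring

theorem rootedClusterSum_le_of_zetaCriterion (hu : ∀ x y, u x y = u y x)
    (hm : Measurable fun p : X × X => u p.1 p.2)
    (hbm : Measurable b) (hst : Stable μ u b) {a : X → ℝ} (ha : ∀ x, 0 ≤ a x)
    (hcrit : ZetaCriterion μ u a b) :
    ∀ᵐ x ∂μ.variation, rootedClusterSum μ u x ≤
      ENNReal.ofReal ((Real.exp (a x) - 1) * Real.exp (2 * b x)) := by
  have h := rootedClusterSum_le hu
    (K := fun e => ENNReal.ofReal ‖expNeg (symmPotential u hu e) - 1‖)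
    (c := fun x => ENNReal.ofReal (Real.exp (2 * b x)))
    ((measurable_expNeg.comp hm).sub_const 1).norm.ennreal_ofReal
    (Real.measurable_exp.comp (hbm.const_mul 2)).ennreal_ofReal
    (fun n => hst.ae_connSum_le_zeta hu n) ha (hcrit.mono fun x hx => ?_)
  · filter_upwards [h] with x hx
    rwa [mul_comm (_ - _), ENNReal.ofReal_mul (Real.exp_pos _).le]
  · refine le_trans (le_of_eq (lintegral_congr fun y => ?_)) hx
    rw [mul_assoc, ← ENNReal.ofReal_mul (Real.exp_pos _).le, ← Real.exp_add,
      ← ENNReal.ofReal_mul (norm_nonneg _), add_comm (2 * b y)]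
    rfl

theorem rootedClusterSum_le_of_ubarCriterion (hu : ∀ x y, u x y = u y x)
    (hm : Measurable fun p : X × X => u p.1 p.2)
    (hbm : Measurable b) (hb : ∀ x, 0 ≤ b x) (hst : Stable μ u b) {a : X → ℝ}
    (ha : ∀ x, 0 ≤ a x) (hcrit : UbarCriterion μ u a b) :
    ∀ᵐ x ∂μ.variation, rootedClusterSum μ u x ≤
      ENNReal.ofReal ((Real.exp (a x) - 1) * Real.exp (b x)) := by
  have h := rootedClusterSum_le hu
    (K := fun e => ENNReal.ofReal ‖(symmPotential u hu e).untopD 1‖)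
    (c := fun x => ENNReal.ofReal (Real.exp (b x)))
    ((measurable_untopD 1).comp hm).norm.ennreal_ofReal
    (Real.measurable_exp.comp hbm).ennreal_ofReal
    (fun n => hst.ae_connSum_le_ubar hu hb n) ha (hcrit.mono fun x hx => ?_)
  · filter_upwards [h] with x hx
    rwa [mul_comm (_ - _), ENNReal.ofReal_mul (Real.exp_pos _).le]
  · refine le_trans (le_of_eq (lintegral_congr fun y => ?_)) hx
    rw [mul_assoc, ← ENNReal.ofReal_mul (Real.exp_pos _).le, ← Real.exp_add,
      ← ENNReal.ofReal_mul (norm_nonneg _), add_comm (b y)]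
    rfl

end Stability

end ClusterExpansion

end

noncomputable section

namespace ClusterExpansion

open Finset

section Convergence

variable {X : Type*} [MeasurableSpace X]

theorem lintegral_absPi_succ (μ : ComplexMeasure X) [IsFiniteMeasure μ.variation] {n : ℕ}
    {f : (Fin (n + 1) → X) → ℝ≥0∞} (hf : Measurable f) :
    ∫⁻ x, f x ∂absPi μ (n + 1) = ∫⁻ x, ∫⁻ y : Fin n → X, f (Fin.cons x y) ∂absPi μ n ∂μ.variation := by
  have h := (measurePreserving_cons μ.variation n).lintegral_comp hf
  rw [absPi, ← h]
  exact lintegral_prod _ (hf.comp (measurableEmbedding_cons n).measurable).aemeasurable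

theorem lintegral_prod_comp (μ : ComplexMeasure X) [IsFiniteMeasure μ.variation] {c : X → ℝ≥0∞}
    (hc : Measurable c) (n : ℕ) :
    ∫⁻ x, ∏ i, c (x i) ∂absPi μ n = (∫⁻ x, c x ∂μ.variation) ^ n := by
  induction n with
  | zero => simp [absPi]
  | succ n ih =>
    rw [lintegral_absPi_succ μ (measurable_prod_comp hc _), pow_succ', ← ih,
      ← lintegral_mul_const _ hc]
    refine lintegral_congr fun x => ?_
    simp only [Fin.prod_univ_succ, Fin.cons_zero, Fin.cons_succ]
    exact lintegral_const_mul _ (measurable_prod_comp hc _)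

variable {u : X → X → WithTop ℂ} {μ : ComplexMeasure X} [IsFiniteMeasure μ.variation] {b : X → ℝ}

theorem Stable.lintegral_boltzmann_le (hu : ∀ x y, u x y = u y x) (hst : Stable μ u b)
    (hbm : Measurable b) (n : ℕ) :
    ∫⁻ x, ENNReal.ofReal ‖boltzmann u x‖ ∂absPi μ n ≤
      (∫⁻ x, ENNReal.ofReal (Real.exp (b x)) ∂μ.variation) ^ n := by
  have hc : Measurable fun x => ENNReal.ofReal (Real.exp (b x)) :=
    (Real.measurable_exp.comp hbm).ennreal_ofReal
  rw [← lintegral_prod_comp μ hc]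
  refine lintegral_mono_ae ?_
  filter_upwards [hst.ae_forall hu n] with x hx
  rw [boltzmann_eq_fullProd hu, fullProd, norm_prod,
    ← ENNReal.ofReal_prod_of_nonneg fun _ _ => (Real.exp_pos _).le]
  exact ENNReal.ofReal_le_ofReal (hx univ)

theorem tsum_succ_mul_lintegral_phi_lt_top (hu : ∀ x y, u x y = u y x)
    (hm : Measurable fun p : X × X => u p.1 p.2) {g : X → ℝ≥0∞}
    (hroot : ∀ᵐ x ∂μ.variation, rootedClusterSum μ u x ≤ g x)
    (hg : ∫⁻ x, g x ∂μ.variation < ∞) :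
    ∑' m : ℕ, ((m + 1 : ℕ) : ℝ≥0∞) * ∫⁻ x, ENNReal.ofReal ‖phi u x‖ ∂absPi μ (m + 1) < ∞ := by
  have hphi : ∀ m, Measurable fun x : Fin (m + 1) → X => ENNReal.ofReal ‖phi u x‖ := fun m =>
    (measurable_phi hu hm m).norm.ennreal_ofReal
  rw [tsum_eq_zero_add' ENNReal.summable]
  refine ENNReal.add_lt_top.2 ⟨?_, lt_of_le_of_lt ?_ hg⟩
  · simp [phi_one]
  · refine le_trans (le_of_eq ?_) (lintegral_mono_ae hroot)
    have hmeas : ∀ m, Measurable fun x => ∫⁻ y : Fin (m + 1) → X,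
        ENNReal.ofReal ‖phi u (Fin.cons x y : Fin (m + 2) → X)‖ ∂absPi μ (m + 1) := fun m =>
      Measurable.lintegral_prod_right'
        (f := fun p : X × (Fin (m + 1) → X) =>
          ENNReal.ofReal ‖phi u (Fin.cons p.1 p.2 : Fin (m + 2) → X)‖)
        ((hphi (m + 1)).comp (measurableEmbedding_cons (m + 1)).measurable)
    simp only [rootedClusterSum]
    rw [lintegral_tsum fun m => ((hmeas m).const_mul _).aemeasurable]
    refine tsum_congr fun m => ?_
    rw [lintegral_const_mul _ (hmeas m), lintegral_absPi_succ μ (hphi _)]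

theorem integrable_of_lintegral_ofReal {α : Type*} [MeasurableSpace α] {ν : Measure α}
    {f : α → ℂ} (hf : Measurable f) (h : ∫⁻ x, ENNReal.ofReal ‖f x‖ ∂ν < ∞) : Integrable f ν :=
  ⟨hf.aestronglyMeasurable, by simpa only [HasFiniteIntegral, ofReal_norm] using h⟩

theorem norm_iterIntegral_le {n : ℕ} {f : (Fin n → X) → ℂ} (hf : Integrable f (absPi μ n)) :
    ‖iterIntegral μ n f‖ ≤ (∫⁻ x, ENNReal.ofReal ‖f x‖ ∂absPi μ n).toReal := by
  obtain ⟨h, hm, hn, hμ⟩ := exists_polar μ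
  rw [iterIntegral_eq hm hn hμ hf]
  refine (norm_integral_le_lintegral_norm _).trans (le_of_eq ?_)
  simp [hn]

end Convergence

section Recursion

variable {X : Type*} [MeasurableSpace X] {u : X → X → WithTop ℂ} (hu : ∀ x y, u x y = u y x)

/-- Splitting the integral of the Boltzmann factor at the cluster of the first point. -/
theorem integral_fullProd_succ {ν : Measure X} [IsFiniteMeasure ν] {h : X → ℂ}
    (hm : Measurable h) (hn : ∀ x, ‖h x‖ = 1)
    (hF : ∀ n, Integrable (fun x : Fin n → X => fullProd (edgeZeta hu x) univ)
      (Measure.pi fun _ => ν))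
    (hC : ∀ n, Integrable (fun x : Fin (n + 1) → X => connSum (edgeZeta hu x) univ)
      (Measure.pi fun _ => ν)) (n : ℕ) :
    ∫ x : Fin (n + 1) → X, fullProd (edgeZeta hu x) univ * ∏ i, h (x i) ∂Measure.pi (fun _ => ν) =
      ∑ k ∈ range (n + 1), (n.choose k : ℂ) *
        ((∫ x : Fin (k + 1) → X, connSum (edgeZeta hu x) univ * ∏ i, h (x i)
            ∂Measure.pi fun _ => ν) *
          ∫ x : Fin (n - k) → X, fullProd (edgeZeta hu x) univ * ∏ i, h (x i)
            ∂Measure.pi fun _ => ν) := by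
  set V : Finset (Fin (n + 1)) := univ.erase 0
  set c : ∀ k, (Fin (k + 1) → X) → ℂ := fun k x => connSum (edgeZeta hu x) univ * ∏ i, h (x i)
  set z : ∀ k, (Fin k → X) → ℂ := fun k x => fullProd (edgeZeta hu x) univ * ∏ i, h (x i)
  have hci : ∀ k, Integrable (c k) (Measure.pi fun _ => ν) := fun k =>
    integrable_mul_prod_phase hm hn (hC k)
  have hzi : ∀ k, Integrable (z k) (Measure.pi fun _ => ν) := fun k =>
    integrable_mul_prod_phase hm hn (hF k)
  have hpt : ∀ x : Fin (n + 1) → X, fullProd (edgeZeta hu x) univ * ∏ i, h (x i) =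
      ∑ S ∈ V.powerset, connSum (edgeZeta hu x) (insert 0 S) *
        fullProd (edgeZeta hu x) (V \ S) * ∏ i, h (x i) := by
    intro x
    rw [← sum_mul, ← fullProd_insert _ (notMem_erase _ _), insert_erase (mem_univ _)]
  have hsplit : ∀ S ⊆ V, ∀ e : Fin (S.card + 1) ⊕ Fin (n - S.card) ≃ Fin (n + 1),
      (univ.map (Function.Embedding.inl.trans e.toEmbedding) = insert 0 S) →
      (univ.map (Function.Embedding.inr.trans e.toEmbedding) = (insert 0 S)ᶜ) →
      (fun x : Fin (n + 1) → X => connSum (edgeZeta hu x) (insert 0 S) *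
        fullProd (edgeZeta hu x) (V \ S) * ∏ i, h (x i)) =
      fun x => c S.card (fun i => x (e (Sum.inl i))) * z (n - S.card) (fun i => x (e (Sum.inr i))) := by
    intro S hS e e1 e2
    funext x
    have p1 : ∏ i, h (x i) = (∏ i, h (x (e (Sum.inl i)))) * ∏ i, h (x (e (Sum.inr i))) := by
      rw [← Equiv.prod_comp e, Fintype.prod_sum_type]
    have p2 : connSum (edgeZeta hu x) (insert 0 S) =
        connSum (edgeZeta hu fun i => x (e (Sum.inl i))) univ := by
      rw [← e1, connSum_map _ _ univ_nonempty]
      refine congrArg (fun w => connSum w univ) (funext fun f => ?_)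
      rw [edgeZeta, Sym2.map_map]
      rfl
    have p3 : fullProd (edgeZeta hu x) (V \ S) =
        fullProd (edgeZeta hu fun i => x (e (Sum.inr i))) univ := by
      rw [← compl_insert_zero, ← e2, fullProd_map]
      refine congrArg (fun w => fullProd w univ) (funext fun f => ?_)
      rw [edgeZeta, Sym2.map_map]
      rfl
    rw [p1, p2, p3]
    ring
  have hmp : ∀ S ⊆ V, Integrable (fun x : Fin (n + 1) → X => connSum (edgeZeta hu x) (insert 0 S) *
        fullProd (edgeZeta hu x) (V \ S) * ∏ i, h (x i)) (Measure.pi fun _ => ν) ∧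
      ∫ x : Fin (n + 1) → X, connSum (edgeZeta hu x) (insert 0 S) *
        fullProd (edgeZeta hu x) (V \ S) * ∏ i, h (x i) ∂Measure.pi (fun _ => ν) =
      (∫ x, c S.card x ∂Measure.pi fun _ => ν) * ∫ x, z (n - S.card) x ∂Measure.pi fun _ => ν := by
    intro S hS
    have hk := card_insert_zero hS
    have hm' := card_compl_insert_zero hS
    set e := finSumEquivOfFinset hk hm' with he
    have e1 := map_finSumEquivOfFinset_inl hk hm'
    have e2 := map_finSumEquivOfFinset_inr hk hm'
    rw [hsplit S hS e e1 e2]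
    have mp := measurePreserving_split ν e
    have hi := (hci S.card).mul_prod (hzi (n - S.card))
    refine ⟨mp.integrable_comp_of_integrable hi, ?_⟩
    rw [← integral_prod_mul, ← mp.map_eq, integral_map mp.measurable.aemeasurable]
    rw [mp.map_eq]
    exact hi.aestronglyMeasurable
  simp_rw [hpt]
  rw [integral_finsetSum _ fun S hS => (hmp S (mem_powerset.1 hS)).1]
  exact sum_powerset_erase_zero _ (fun k => (∫ x, c k x ∂Measure.pi fun _ => ν) *
    ∫ x, z (n - k) x ∂Measure.pi fun _ => ν) fun S hS => (hmp S hS).2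

theorem succ_mul_partitionTerm_succ (hu : ∀ x y, u x y = u y x) {μ : ComplexMeasure X}
    [IsFiniteMeasure μ.variation]
    (hF : ∀ n, Integrable (fun x : Fin n → X => boltzmann u x) (absPi μ n))
    (hC : ∀ n, Integrable (fun x : Fin (n + 1) → X => phi u x) (absPi μ (n + 1))) (n : ℕ) :
    (n + 1 : ℂ) * partitionTerm μ u (n + 1) =
      ∑ k ∈ range (n + 1), (k + 1 : ℂ) * clusterTerm μ u (k + 1) * partitionTerm μ u (n - k) := by
  obtain ⟨h, hm, hn, hμ⟩ := exists_polar μ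
  have hfac : ∀ k : ℕ, ((k ! : ℕ) : ℂ) ≠ 0 := fun k => Nat.cast_ne_zero.2 k.factorial_ne_zero
  have hC' : ∀ n, Integrable (fun x : Fin (n + 1) → X => connSum (edgeZeta hu x) univ)
      (absPi μ (n + 1)) := by
    intro n
    refine ((hC n).const_mul (((n + 1)! : ℕ) : ℂ)).congr (.of_forall fun x => ?_)
    simp only [phi_eq_connSum hu]
    rw [mul_inv_cancel_left₀ (hfac _)]
  have hp : ∀ n, partitionTerm μ u n = ((n ! : ℕ) : ℂ)⁻¹ *
      ∫ x : Fin n → X, fullProd (edgeZeta hu x) univ * ∏ i, h (x i) ∂absPi μ n := by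
    intro n
    rw [partitionTerm, iterIntegral_eq hm hn hμ (hF n)]
    simp only [boltzmann_eq_fullProd hu]
  have hc : ∀ k, clusterTerm μ u (k + 1) = (((k + 1)! : ℕ) : ℂ)⁻¹ *
      ∫ x : Fin (k + 1) → X, connSum (edgeZeta hu x) univ * ∏ i, h (x i) ∂absPi μ (k + 1) := by
    intro k
    rw [clusterTerm, iterIntegral_eq hm hn hμ (hC k), ← integral_const_mul]
    refine integral_congr_ae (.of_forall fun x => ?_)
    simp only [phi_eq_connSum hu]
    ring
  have key := integral_fullProd_succ hu (ν := μ.variation) hm hn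
    (fun n => by simpa only [boltzmann_eq_fullProd hu, absPi] using hF n) hC' n
  have hsucc : ∀ k : ℕ, (k + 1 : ℂ) * (((k + 1)! : ℕ) : ℂ)⁻¹ = ((k ! : ℕ) : ℂ)⁻¹ := by
    intro k
    have h1 : (k + 1 : ℂ) ≠ 0 := Nat.cast_add_one_ne_zero k
    rw [Nat.factorial_succ]
    push_cast
    rw [mul_inv, mul_inv_cancel_left₀ h1]
  rw [hp, ← mul_assoc, hsucc, absPi, key, mul_sum]
  refine sum_congr rfl fun k hk => ?_
  rw [hc, hp, ← mul_assoc (k + 1 : ℂ), hsucc,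
    Nat.cast_choose ℂ (Nat.lt_succ_iff.1 (mem_range.1 hk))]
  have h1 := hfac n
  have h2 := hfac k
  have h3 := hfac (n - k)
  simp only [absPi]
  field_simp

end Recursion

end ClusterExpansion

end

open ClusterExpansion in
theorem theorem1 {X : Type*} [MeasurableSpace X] (μ : ComplexMeasure X)
    (u : X → X → WithTop ℂ)
    (hu_meas : Measurable fun p : X × X => u p.1 p.2)
    (hu_symm : ∀ x y, u x y = u y x)
    (a b : X → ℝ) (ha_meas : Measurable a) (hb_meas : Measurable b)
    (ha : ∀ x, 0 ≤ a x) (hb : ∀ x, 0 ≤ b x)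
    (hstab : Stable μ u b)
    (hcrit : ZetaCriterion μ u a b ∨ UbarCriterion μ u a b)
    (hint : ∫⁻ y, ENNReal.ofReal (Real.exp (a y + 2 * b y)) ∂μ.variation < ∞) :
    -- the series defining the partition function converges absolutely
    ((∑' n : ℕ, ((n ! : ℕ) : ℝ≥0∞)⁻¹ *
        ∫⁻ x, ENNReal.ofReal ‖boltzmann u x‖ ∂absPi μ n) < ∞ ∧
      Summable fun n : ℕ => partitionTerm μ u n) ∧
    -- the series in the exponential (over n ≥ 1) converges absolutely
    ((∑' m : ℕ, ∫⁻ x, ENNReal.ofReal ‖phi u x‖ ∂absPi μ (m + 1)) < ∞ ∧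
      Summable fun m : ℕ => clusterTerm μ u (m + 1)) ∧
    -- the cluster expansion
    partitionFunction μ u = Complex.exp (∑' m : ℕ, clusterTerm μ u (m + 1)) ∧
    -- the bounds on the rooted cluster sums
    (ZetaCriterion μ u a b → ∀ᵐ x₁ ∂μ.variation,
      rootedClusterSum μ u x₁ ≤
        ENNReal.ofReal ((Real.exp (a x₁) - 1) * Real.exp (2 * b x₁))) ∧
    (UbarCriterion μ u a b → ∀ᵐ x₁ ∂μ.variation,
      rootedClusterSum μ u x₁ ≤
        ENNReal.ofReal ((Real.exp (a x₁) - 1) * Real.exp (b x₁))) := by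
  have : IsFiniteMeasure μ.variation := by
    refine ⟨lt_of_le_of_lt ?_ hint⟩
    rw [← setLIntegral_univ, ← setLIntegral_one, setLIntegral_univ, setLIntegral_univ]
    refine lintegral_mono fun x => ?_
    rw [← ENNReal.ofReal_one]
    exact ENNReal.ofReal_le_ofReal (Real.one_le_exp (by linarith [ha x, hb x]))
  have hZ : ZetaCriterion μ u a b → _ :=
    rootedClusterSum_le_of_zetaCriterion hu_symm hu_meas hb_meas hstab ha
  have hU : UbarCriterion μ u a b → _ :=
    rootedClusterSum_le_of_ubarCriterion hu_symm hu_meas hb_meas hb hstab ha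
  have hroot : ∀ᵐ x ∂μ.variation, rootedClusterSum μ u x ≤
      ENNReal.ofReal (Real.exp (a x + 2 * b x)) := by
    rcases hcrit with h | h
    · filter_upwards [hZ h] with x hx
      refine hx.trans (ENNReal.ofReal_le_ofReal ?_)
      rw [Real.exp_add]
      gcongr
      linarith
    · filter_upwards [hU h] with x hx
      refine hx.trans (ENNReal.ofReal_le_ofReal ?_)
      rw [Real.exp_add]
      gcongr
      · linarith
      · linarith [hb x]
  -- the cluster terms
  have hphi := tsum_succ_mul_lintegral_phi_lt_top hu_symm hu_meas hroot hint
  set I : ℕ → ℝ≥0∞ := fun m => ∫⁻ x, ENNReal.ofReal ‖phi u x‖ ∂absPi μ (m + 1)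
  have hI_lt : ∑' m, I m < ∞ := by
    refine lt_of_le_of_lt (ENNReal.tsum_le_tsum fun m => ?_) hphi
    exact le_mul_of_one_le_left zero_le (by exact_mod_cast m.succ_pos)
  have hphi_int : ∀ m, Integrable (fun x : Fin (m + 1) → X => phi u x) (absPi μ (m + 1)) :=
    fun m => integrable_of_lintegral_ofReal (measurable_phi hu_symm hu_meas m)
      (lt_of_le_of_lt (ENNReal.le_tsum m) hI_lt)
  have hc_sum : Summable fun m : ℕ => (m + 1 : ℝ) * ‖clusterTerm μ u (m + 1)‖ := by
    refine Summable.of_nonneg_of_le (fun m => by positivity) (fun m => ?_)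
      (ENNReal.summable_toReal hphi.ne)
    rw [ENNReal.toReal_mul, ENNReal.toReal_natCast, Nat.cast_add_one]
    gcongr
    exact norm_iterIntegral_le (hphi_int m)
  have hc_summable : Summable fun m : ℕ => clusterTerm μ u (m + 1) := by
    refine Summable.of_norm_bounded hc_sum fun m => ?_
    exact le_mul_of_one_le_left (norm_nonneg _) (by linarith [(Nat.cast_nonneg m : (0 : ℝ) ≤ m)])
  -- the terms of the partition function
  set M : ℝ≥0∞ := ∫⁻ x, ENNReal.ofReal (Real.exp (b x)) ∂μ.variation
  have hM_lt : M < ∞ := by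
    refine lt_of_le_of_lt (lintegral_mono fun x => ?_) hint
    exact ENNReal.ofReal_le_ofReal (Real.exp_le_exp.2 (by linarith [ha x, hb x]))
  have hboltz : ∀ n, ∫⁻ x, ENNReal.ofReal ‖boltzmann u x‖ ∂absPi μ n ≤ M ^ n :=
    hstab.lintegral_boltzmann_le hu_symm hb_meas
  have hboltz_int : ∀ n, Integrable (fun x : Fin n → X => boltzmann u x) (absPi μ n) :=
    fun n => integrable_of_lintegral_ofReal (measurable_boltzmann hu_symm hu_meas n)
      (lt_of_le_of_lt (hboltz n) (ENNReal.pow_lt_top hM_lt))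
  have hp_le : ∀ n, ‖partitionTerm μ u n‖ ≤ M.toReal ^ n / n ! := by
    intro n
    rw [partitionTerm, norm_mul, norm_inv, Complex.norm_natCast, inv_mul_eq_div]
    gcongr
    refine (norm_iterIntegral_le (hboltz_int n)).trans ?_
    rw [← ENNReal.toReal_pow]
    exact ENNReal.toReal_mono (ENNReal.pow_lt_top hM_lt).ne (hboltz n)
  have hexp := Real.summable_pow_div_factorial M.toReal
  have hp_sum : Summable fun n : ℕ => (n + 1 : ℝ) * ‖partitionTerm μ u (n + 1)‖ := by
    refine Summable.of_nonneg_of_le (fun n => by positivity) (fun n => ?_) (hexp.mul_left M.toReal)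
    refine (mul_le_mul_of_nonneg_left (hp_le (n + 1)) (by positivity)).trans (le_of_eq ?_)
    rw [Nat.factorial_succ]
    push_cast
    field_simp
    ring
  have hp0 : partitionTerm μ u 0 = 1 := by
    simp [partitionTerm, iterIntegral, boltzmann, pairs, expNeg_zero]
  refine ⟨⟨?_, .of_norm_bounded hexp hp_le⟩, ⟨hI_lt, hc_summable⟩, ?_, hZ, hU⟩
  · refine lt_of_le_of_lt (ENNReal.tsum_le_tsum fun n => mul_le_mul_right (hboltz n) _) ?_
    have h : ∀ n : ℕ, ((n ! : ℕ) : ℝ≥0∞)⁻¹ * M ^ n = ENNReal.ofReal (M.toReal ^ n / n !) := by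
      intro n
      rw [ENNReal.ofReal_div_of_pos (by positivity), ENNReal.ofReal_pow ENNReal.toReal_nonneg,
        ENNReal.ofReal_toReal hM_lt.ne, ENNReal.ofReal_natCast, ENNReal.div_eq_inv_mul]
    simp_rw [h]
    exact hexp.tsum_ofReal_lt_top
  · exact tsum_eq_exp_tsum hp_sum hc_sum hp0
      (succ_mul_partitionTerm_succ hu_symm hboltz_int hphi_int)
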